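/- **Setting.** Let $N\ge 1$, let $\lambda$ be a partition of $N$, and let $K$ be an extension field of $\mathbb Q(s,q)$ ($s,q$ algebraically independent over $\mathbb Q$), for instance $K=\mathbb C(s,q)$. All operators act on the right, so $AB$ means "first $A$, then $B$". The diagram of $\lambda$ is drawn with its longest row at the bottom, and the content of a cell is its column minus its row. *The module $V_\lambda$.* A reverse standard tableau (RST) of shape $\lambda$ is a filling of the diagram by $1,\dots,N$, each used once, strictly decreasing in each row (left to right) and in each column (bottom to top). For an RST $\mathbb T$ let ${\rm ROW}_{\mathbb T}[i],{\rm COL}_{\mathbb T}[i],{\rm CT}_{\mathbb T}[i]$ be the row, column and content of the entry $i$, and let $\mathbb T^{(i,j)}$ be $\mathbb T$ with the entries $i,j$ exchanged. $V_\lambda$ is the $K$-vector space with basis the RST of shape $\lambda$, with operators $T_i$ ($1\le i<N$) given as follows, where $m={\rm CT}_{\mathbb T}[i+1]-{\rm CT}_{\mathbb T}[i]$: $\mathbb T T_i=s\mathbb T$ if $i,i+1$ are in the same row; $\mathbb T T_i=-\mathbb T$ if they are in the same column; $\mathbb T T_i=\mathbb T^{(i,i+1)}-\frac{1-s}{1-s^m}\mathbb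 T$ if ${\rm ROW}_{\mathbb T}[i]<{\rm ROW}_{\mathbb T}[i+1]$ and the columns differ; $\mathbb T T_i=\frac{s-1}{1-s^m}\mathbb T+\frac{s(1-s^{m+1})(1-s^{m-1})}{(1-s^m)^2}\mathbb T^{(i,i+1)}$ if ${\rm ROW}_{\mathbb T}[i]>{\rm ROW}_{\mathbb T}[i+1]$ and the columns differ. *Vector valued polynomials.* On $\mathcal M_\lambda=K[x_1,\dots,x_N]\otimes V_\lambda$ put, for a polynomial $p$ and $u\in V_\lambda$, $$(p\otimes u)\mathbf T_i=(1-s)\,x_{i+1}\frac{p-ps_i}{x_i-x_{i+1}}\otimes u+ps_i\otimes uT_i ,$$ where $ps_i$ is $p$ with $x_i,x_{i+1}$ exchanged. Further $\mathbf T_i^{-1}=\frac1s(\mathbf T_i+1-s)$ and $\boldsymbol\Phi=\mathbf T_1^{-1}\cdots\mathbf T_{N-1}^{-1}x_N$. *Yang–Baxter graph.* Vertices are the pairs $(\mathbb T,v)$ with $\mathbb T$ an RST of shape $\lambda$ and $v\in\mathbb N^N$. Let $r_v[i]=\#\{j\le i:v[j]\ge v[i]\}+\#\{j>i:v[j]>v[i]\}$,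 and let the spectral vector be $\zeta=\zeta_{v,\mathbb T}$, $\zeta[i]=q^{v[i]}s^{{\rm CT}_{\mathbb T}[r_v[i]]}$. Write $q^as^b\succ q^cs^d$ if $a>c$, or $a=c$ and $b\le d-2$. If $\zeta[i+1]\succ\zeta[i]$ there is an arrow labelled $s_i$ from $(\mathbb T,v)$ to the vertex with spectral vector $\zeta s_i$ ($\zeta[i],\zeta[i+1]$ exchanged); this vertex is $(\mathbb T,vs_i)$ if $v[i]<v[i+1]$ and $(\mathbb T^{(r_v[i],r_v[i+1])},v)$ if $v[i]=v[i+1]$. There is an affine arrow from $(\mathbb T,v)$ to $(\mathbb T,[v[2],\dots,v[N],v[1]+1])$. The root is $(\mathbb T_\lambda,0)$, where $\mathbb T_\lambda$ is filled column by column, left to right and each column from bottom to top, by $N,N-1,\dots,1$. *Macdonald polynomials.* To a path starting at the root attach a polynomial: $1\otimes\mathbb T_\lambda$ to the empty path; following an arrow $s_i$ that leaves a vertex with spectral vector $\zeta$ applies $\mathbf T_i+\frac{1-s}{1-\zeta[i+1]/\zeta[i]}$; following an affine arrow applies $\boldsymbol\Phi$. The result depends only on the endpoint $(\mathbb T,v)$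 and is denoted $P_\zeta$, $\zeta=\zeta_{v,\mathbb T}$. *The space $\mathcal M_T$.* Let $T$ be a filling of the diagram of $\lambda$ by nonnegative integers, weakly increasing in each row and each column. Write $\zeta\in T$ if $\zeta=\zeta_{v,\mathbb T}$ and replacing each entry $i$ of $\mathbb T$ by $v^+[i]$ gives $T$, where $v^+$ is the decreasing rearrangement of $v$. Let $\mathcal M_T$ be the span of the $P_\zeta$ with $\zeta\in T$. An element $\mathfrak f\in\mathcal M_T$ is antisymmetric if $\mathfrak f\,\mathbf T_i=-\mathfrak f$ for $1\le i<N$. The root of $T$ is the vertex of $T$ that no arrow $s_i$ enters. **Theorem.** 1. If $T$ is row-strict (strictly increasing in each row), there is exactly one family $(b^a_\zeta)_{\zeta\in T}$ in $K$ with $b^a_\zeta=1$ at the root of $T$ and $$b^a_{\zeta s_i}=-\frac{\zeta[i]-\zeta[i+1]}{\zeta[i]-s\,\zeta[i+1]}\,b^a_\zeta\qquad\text{whenever }\zeta\in T,\ \zeta[i+1]\succ\zeta[i],$$ and the subspace of antisymmetric polynomials of $\mathcal M_T$ is one-dimensional over $K$, generated by $\mathfrak M^a_T=\sum_{\zeta\in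 T}b^a_\zeta P_\zeta$. 2. If $T$ is not row-strict, the subspace of antisymmetric polynomials of $\mathcal M_T$ is $0$. -/

import Mathlib

open scoped TensorProduct

noncomputable section

namespace VVMac

/-! ### Reverse standard tableaux

`N = n + 1`, and indices and entries `1, …, N` are the elements `0, …, n` of `Fin (n + 1)`.
A cell of a Young diagram is a pair `(row, column)`; row `0` is the longest row (drawn at the
bottom), and rows are stacked upwards. -/

/-- A bijective filling of the diagram `lam` by the entries `0, …, n`, given by the cell of each
entry, is reverse standard if its entries strictly decrease along each row and each column. -/
def IsRST {n : ℕ} {lam : YoungDiagram} (pos : Fin (n + 1) ≃ lam.cells) : Prop :=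
  (∀ a b, (pos a).1.1 = (pos b).1.1 → (pos a).1.2 < (pos b).1.2 → b < a) ∧
  (∀ a b, (pos a).1.2 = (pos b).1.2 → (pos a).1.1 < (pos b).1.1 → b < a)

/-- The set `Tab_λ` of reverse standard tableaux of shape `lam`. -/
def RST (n : ℕ) (lam : YoungDiagram) : Type :=
  {pos : Fin (n + 1) ≃ lam.cells // IsRST pos}

/-- Row of the entry `a`. -/
def RST.row {n : ℕ} {lam : YoungDiagram} (t : RST n lam) (a : Fin (n + 1)) : ℕ := (t.1 a).1.1

/-- Column of the entry `a`. -/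
def RST.col {n : ℕ} {lam : YoungDiagram} (t : RST n lam) (a : Fin (n + 1)) : ℕ := (t.1 a).1.2

/-- Content of the entry `a`: column minus row. -/
def RST.ct {n : ℕ} {lam : YoungDiagram} (t : RST n lam) (a : Fin (n + 1)) : ℤ :=
  (t.col a : ℤ) - (t.row a : ℤ)

/-- Entries decrease along every south-west to north-east path inside the diagram. -/
theorem IsRST.lt_of_le {n : ℕ} {lam : YoungDiagram} {pos : Fin (n + 1) ≃ lam.cells}
    (h : IsRST pos) {a b : Fin (n + 1)} (h1 : (pos a).1.1 ≤ (pos b).1.1)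
    (h2 : (pos a).1.2 ≤ (pos b).1.2) (hab : a ≠ b) : b < a := by
  rcases h1.eq_or_lt with e1 | l1
  · rcases h2.eq_or_lt with e2 | l2
    · exact absurd (pos.injective (Subtype.ext (Prod.ext e1 e2))) hab
    · exact h.1 a b e1 l2
  · rcases h2.eq_or_lt with e2 | l2
    · exact h.2 a b e2 l1
    · have hm : ((pos a).1.1, (pos b).1.2) ∈ lam.cells :=
        YoungDiagram.up_left_mem lam l1.le le_rfl (pos b).2
      obtain ⟨c, hc⟩ := pos.surjective ⟨_, hm⟩
      have hc1 : (pos c).1.1 = (pos a).1.1 := by rw [hc]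
      have hc2 : (pos c).1.2 = (pos b).1.2 := by rw [hc]
      exact (h.2 c b hc2 (by omega)).trans (h.1 a c hc1.symm (by omega))

/-- If two consecutive entries lie in different rows and different columns, exchanging them in a
reverse standard tableau gives a reverse standard tableau. -/
theorem IsRST.swap {n : ℕ} {lam : YoungDiagram} {pos : Fin (n + 1) ≃ lam.cells} (h : IsRST pos)
    (i : Fin n) (hr : (pos i.castSucc).1.1 ≠ (pos i.succ).1.1)
    (hc : (pos i.castSucc).1.2 ≠ (pos i.succ).1.2) :
    IsRST ((Equiv.swap i.castSucc i.succ).trans pos) := by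
  have key : ∀ a b : Fin (n + 1), ((pos a).1.1 = (pos b).1.1 ∨ (pos a).1.2 = (pos b).1.2) →
      b < a → Equiv.swap i.castSucc i.succ b < Equiv.swap i.castSucc i.succ a := by
    intro a b hor hba
    have hi : (i.castSucc : Fin (n + 1)).val = i.val := rfl
    have hi' : (i.succ : Fin (n + 1)).val = i.val + 1 := rfl
    rw [Equiv.swap_apply_def, Equiv.swap_apply_def]
    by_cases ha1 : a = i.castSucc
    · by_cases hb1 : b = i.castSucc
      · subst ha1; subst hb1; exact absurd hba (lt_irrefl _)
      · by_cases hb2 : b = i.succ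
        · subst ha1; subst hb2; exact absurd hba (by simp [Fin.lt_def])
        · subst ha1; simp only [hb1, hb2, if_true, if_false]
          rw [Fin.lt_def] at *; omega
    · by_cases ha2 : a = i.succ
      · by_cases hb1 : b = i.castSucc
        · subst ha2; subst hb1
          rcases hor with e | e
          · exact absurd e.symm hr
          · exact absurd e.symm hc
        · have hne : ¬ (b.val = i.val) := fun e => hb1 (Fin.ext e)
          have hb2 : b ≠ i.succ := by rintro rfl; exact absurd hba (by simp [ha2])
          subst ha2; simp only [hb1, hb2, if_false, if_true, if_neg ha1]
          rw [Fin.lt_def] at *; omega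
      · by_cases hb1 : b = i.castSucc
        · subst hb1
          have hne : ¬ (a.val = i.val + 1) := fun e => ha2 (Fin.ext e)
          simp only [ha1, ha2, if_true, if_false]
          rw [Fin.lt_def] at *; omega
        · by_cases hb2 : b = i.succ
          · subst hb2; simp only [ha1, ha2, hb1, if_true, if_false]
            rw [Fin.lt_def] at *; omega
          · simp only [ha1, ha2, hb1, hb2, if_false]; exact hba
  refine ⟨fun a b e l => ?_, fun a b e l => ?_⟩
  · simp only [Equiv.trans_apply] at e l
    have := key _ _ (Or.inl e) (h.1 _ _ e l)
    simpa using this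
  · simp only [Equiv.trans_apply] at e l
    have := key _ _ (Or.inr e) (h.2 _ _ e l)
    simpa using this

/-- The tableau `𝕋^{(i,i+1)}`: the entries `i`, `i + 1` exchanged. -/
def RST.swap {n : ℕ} {lam : YoungDiagram} (t : RST n lam) (i : Fin n)
    (hr : t.row i.castSucc ≠ t.row i.succ) (hc : t.col i.castSucc ≠ t.col i.succ) : RST n lam :=
  ⟨(Equiv.swap i.castSucc i.succ).trans t.1, t.2.swap i hr hc⟩

/-! ### The Hecke algebra module `V_λ` -/

/-- `V_λ`: the vector space with basis `Tab_λ`. -/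
abbrev V (K : Type*) [Field K] (n : ℕ) (lam : YoungDiagram) : Type _ := RST n lam →₀ K

open Classical in
/-- The image `𝕋 T_i` of a basis vector. -/
def tabTBasis {K : Type*} [Field K] {n : ℕ} {lam : YoungDiagram} (s : K) (i : Fin n)
    (t : RST n lam) : V K n lam :=
  if hr : t.row i.castSucc = t.row i.succ then Finsupp.single t s
  else if hc : t.col i.castSucc = t.col i.succ then Finsupp.single t (-1)
  else
    let m : ℤ := t.ct i.succ - t.ct i.castSucc
    if t.row i.castSucc < t.row i.succ then
      Finsupp.single (t.swap i hr hc) 1 - Finsupp.single t ((1 - s) / (1 - s ^ m))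
    else
      Finsupp.single t ((s - 1) / (1 - s ^ m)) +
        Finsupp.single (t.swap i hr hc)
          (s * (1 - s ^ (m + 1)) * (1 - s ^ (m - 1)) / (1 - s ^ m) ^ 2)

/-- The operator `T_i` on `V_λ`. -/
def tabT {K : Type*} [Field K] {n : ℕ} {lam : YoungDiagram} (s : K) (i : Fin n) :
    V K n lam →ₗ[K] V K n lam :=
  Finsupp.linearCombination K (tabTBasis s i)

/-! ### Operators on polynomials -/

/-- Polynomials in `x_1, …, x_N`. -/
abbrev Poly (K : Type*) [Field K] (n : ℕ) : Type _ := MvPolynomial (Fin (n + 1)) K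

/-- The operator `s_i^x` exchanging the variables `x_i` and `x_{i+1}`. -/
def polyS {K : Type*} [Field K] {n : ℕ} (i : Fin n) : Poly K n →ₗ[K] Poly K n :=
  (MvPolynomial.rename (Equiv.swap i.castSucc i.succ)).toLinearMap

theorem divDiff_dvd {K : Type*} [Field K] {n : ℕ} (i : Fin n) (p : Poly K n) :
    (MvPolynomial.X i.castSucc - MvPolynomial.X i.succ : Poly K n) ∣ p - polyS i p := by
  induction p using MvPolynomial.induction_on with
  | C a => simp [polyS]
  | add p r hp hr =>
    have : p + r - polyS i (p + r) = (p - polyS i p) + (r - polyS i r) := by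
      rw [map_add]; ring
    rw [this]; exact dvd_add hp hr
  | mul_X p k hp =>
    have h1 : polyS i (p * MvPolynomial.X k) =
        polyS i p * MvPolynomial.X (Equiv.swap i.castSucc i.succ k) := by simp [polyS]
    have h2 : p * MvPolynomial.X k - polyS i (p * MvPolynomial.X k) =
        (p - polyS i p) * MvPolynomial.X k +
          polyS i p * (MvPolynomial.X k - MvPolynomial.X (Equiv.swap i.castSucc i.succ k)) := by
      rw [h1]; ring
    rw [h2]
    refine dvd_add (hp.mul_right _) (Dvd.dvd.mul_left ?_ _)
    rw [Equiv.swap_apply_def]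
    split_ifs with e1 e2
    · rw [e1]
    · rw [e2, ← neg_sub, neg_dvd]
    · simp

theorem X_sub_X_ne_zero {K : Type*} [Field K] {n : ℕ} (i : Fin n) :
    (MvPolynomial.X i.castSucc - MvPolynomial.X i.succ : Poly K n) ≠ 0 := by
  intro h
  have := MvPolynomial.X_injective (R := K) (sub_eq_zero.mp h)
  simp [Fin.ext_iff] at this

/-- The divided difference `∂_i`: the unique `r` with `(x_i - x_{i+1}) r = p - p s_i`. -/
def divDiff {K : Type*} [Field K] {n : ℕ} (i : Fin n) : Poly K n →ₗ[K] Poly K n where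
  toFun p := (divDiff_dvd i p).choose
  map_add' p r := by
    apply mul_left_cancel₀ (X_sub_X_ne_zero (K := K) i)
    rw [mul_add, ← (divDiff_dvd i (p + r)).choose_spec, ← (divDiff_dvd i p).choose_spec,
      ← (divDiff_dvd i r).choose_spec, map_add]
    ring
  map_smul' c p := by
    apply mul_left_cancel₀ (X_sub_X_ne_zero (K := K) i)
    rw [← (divDiff_dvd i (c • p)).choose_spec, RingHom.id_apply, mul_smul_comm,
      ← (divDiff_dvd i p).choose_spec, map_smul, smul_sub]

theorem divDiff_spec {K : Type*} [Field K] {n : ℕ} (i : Fin n) (p : Poly K n) :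
    (MvPolynomial.X i.castSucc - MvPolynomial.X i.succ) * divDiff i p = p - polyS i p :=
  (divDiff_dvd i p).choose_spec.symm

/-- `δ_i^x`: `p ↦ (1 - s) x_{i+1} ∂_i p`. -/
def polyDelta {K : Type*} [Field K] {n : ℕ} (s : K) (i : Fin n) : Poly K n →ₗ[K] Poly K n :=
  (1 - s) • (LinearMap.mulLeft K (MvPolynomial.X i.succ) ∘ₗ divDiff i)

/-! ### Vector valued polynomials

The operators act on the right in the usual notation: a product `A B` means "first `A`, then `B`",
that is the composition `B ∘ₗ A` of linear maps. -/

/-- The space `𝓜_λ = K[x_1, …, x_N] ⊗ V_λ`. -/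
abbrev M (K : Type*) [Field K] (n : ℕ) (lam : YoungDiagram) : Type _ :=
  Poly K n ⊗[K] V K n lam

/-- The operator `𝐓_i = δ_i^x + s_i^x T_i` on vector valued polynomials. -/
def bT {K : Type*} [Field K] {n : ℕ} {lam : YoungDiagram} (s : K) (i : Fin n) :
    M K n lam →ₗ[K] M K n lam :=
  TensorProduct.map (polyDelta s i) LinearMap.id + TensorProduct.map (polyS i) (tabT s i)

/-- The operator `𝐓_i⁻¹ = (1/s) (𝐓_i + (1 - s))`. -/
def bTinv {K : Type*} [Field K] {n : ℕ} {lam : YoungDiagram} (s : K) (i : Fin n) :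
    M K n lam →ₗ[K] M K n lam :=
  s⁻¹ • (bT s i + (1 - s) • LinearMap.id)

/-- The raising operator `𝚽 = 𝐓_1⁻¹ ⋯ 𝐓_{N-1}⁻¹ x_N` (first `𝐓_1⁻¹`, last multiplication
by `x_N`). -/
def bPhi {K : Type*} [Field K] {n : ℕ} {lam : YoungDiagram} (s : K) :
    M K n lam →ₗ[K] M K n lam :=
  TensorProduct.map (LinearMap.mulLeft K (MvPolynomial.X (Fin.last n))) LinearMap.id ∘ₗ
    (List.ofFn fun i : Fin n => bTinv s i).foldl (fun f g => g ∘ₗ f) LinearMap.id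

/-! ### The Yang–Baxter graph -/

/-- A vertex is labelled by a reverse standard tableau and a multi-index. -/
abbrev Vertex (n : ℕ) (lam : YoungDiagram) : Type := RST n lam × (Fin (n + 1) → ℕ)

theorem rank_aux {n : ℕ} (v : Fin (n + 1) → ℕ) (i : Fin (n + 1)) :
    (Finset.univ.filter fun j => (j < i ∧ v i ≤ v j) ∨ (i < j ∧ v i < v j)).card < n + 1 := by
  have h : (Finset.univ.filter fun j => (j < i ∧ v i ≤ v j) ∨ (i < j ∧ v i < v j)) ⊆
      Finset.univ.erase i := by
    intro j hj
    rw [Finset.mem_filter] at hj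
    refine Finset.mem_erase.mpr ⟨?_, Finset.mem_univ _⟩
    rintro rfl
    simp at hj
  have := Finset.card_le_card h
  rw [Finset.card_erase_of_mem (Finset.mem_univ _), Finset.card_univ, Fintype.card_fin] at this
  omega

/-- The rank function `r_v`, counted from `0`: the number of `j < i` with `v_j ≥ v_i` plus the
number of `j > i` with `v_j > v_i`. -/
def rank {n : ℕ} (v : Fin (n + 1) → ℕ) (i : Fin (n + 1)) : Fin (n + 1) :=
  ⟨(Finset.univ.filter fun j => (j < i ∧ v i ≤ v j) ∨ (i < j ∧ v i < v j)).card, rank_aux v i⟩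

/-- The spectral vector `ζ_{v,𝕋}[i] = q^{v[i]} s^{CT_𝕋[r_v[i]]}`. -/
def spec {K : Type*} [Field K] {n : ℕ} {lam : YoungDiagram} (s q : K) (x : Vertex n lam)
    (i : Fin (n + 1)) : K :=
  q ^ x.2 i * s ^ x.1.ct (rank x.2 i)

/-- The relation `ζ_{v,𝕋}[j] ≻ ζ_{v,𝕋}[i]`: for `q^a s^b ≻ q^c s^d` iff `a > c`, or `a = c` and
`b ≤ d - 2`. -/
def Succ {n : ℕ} {lam : YoungDiagram} (x : Vertex n lam) (j i : Fin (n + 1)) : Prop :=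
  x.2 i < x.2 j ∨
    (x.2 j = x.2 i ∧ x.1.ct (rank x.2 j) ≤ x.1.ct (rank x.2 i) - 2)

/-- `y = x s_i`, the action of the elementary transposition on a vertex `x = (𝕋, v)`: the entries
`v[i] ≠ v[i+1]` are exchanged, or, if `v[i] = v[i+1]`, the entries `r_v[i]`, `r_v[i+1]` of `𝕋` are
exchanged (`y` being a vertex, the result is again reverse standard). -/
def IsSwap {n : ℕ} {lam : YoungDiagram} (i : Fin n) (x y : Vertex n lam) : Prop :=
  (x.2 i.castSucc ≠ x.2 i.succ ∧ y.1 = x.1 ∧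
      y.2 = x.2 ∘ Equiv.swap i.castSucc i.succ) ∨
  (x.2 i.castSucc = x.2 i.succ ∧ y.2 = x.2 ∧
      y.1.1 = (Equiv.swap (rank x.2 i.castSucc) (rank x.2 i.succ)).trans x.1.1)

/-- There is an arrow labelled `s_i` (a step or a correct jump) from `x` to `y = x s_i`, that is
`v[i] < v[i+1]`, or `v[i] = v[i+1]` and `r_v[i]` is south-east of `r_v[i+1]` in `𝕋`. -/
def Arrow {n : ℕ} {lam : YoungDiagram} (i : Fin n) (x y : Vertex n lam) : Prop :=
  Succ x i.succ i.castSucc ∧ IsSwap i x y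

/-- The affine action on multi-indices: `vΨ = (v_2, …, v_N, v_1 + 1)`. -/
def affine {n : ℕ} (v : Fin (n + 1) → ℕ) : Fin (n + 1) → ℕ :=
  Fin.snoc (α := fun _ => ℕ) (fun i : Fin n => v i.succ) (v 0 + 1)

/-- The root tableau `𝕋_λ`: the columns are filled from left to right, each from bottom to top,
by `N, N - 1, …, 1`. -/
def IsRootTableau {n : ℕ} {lam : YoungDiagram} (t : RST n lam) : Prop :=
  ∀ a b, a < b → t.col b < t.col a ∨ (t.col b = t.col a ∧ t.row b < t.row a)

/-! ### Macdonald polynomials -/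

/-- `IsPathPoly s q x p`: the polynomial `p` is attached to some path (without fall) from the root
`(𝕋_λ, 0)` of the Yang–Baxter graph to the vertex `x`. -/
inductive IsPathPoly {K : Type*} [Field K] {n : ℕ} {lam : YoungDiagram} (s q : K) :
    Vertex n lam → M K n lam → Prop
  | root (t : RST n lam) (ht : IsRootTableau t) :
      IsPathPoly s q (t, 0) ((1 : Poly K n) ⊗ₜ[K] Finsupp.single t (1 : K))
  | arrow (i : Fin n) (x y : Vertex n lam) (p : M K n lam) (hp : IsPathPoly s q x p)
      (h : Arrow i x y) :
      IsPathPoly s q y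
        (bT s i p + ((1 - s) / (1 - spec s q x i.succ / spec s q x i.castSucc)) • p)
  | affine (x : Vertex n lam) (p : M K n lam) (hp : IsPathPoly s q x p) :
      IsPathPoly s q (x.1, affine x.2) (bPhi s p)

open Classical in
/-- The nonsymmetric vector valued Macdonald polynomial `P_{v,𝕋} = P_ζ`: the polynomial attached to
a path from the root to the vertex `(𝕋, v)`. -/
def macdonald {K : Type*} [Field K] {n : ℕ} {lam : YoungDiagram} (s q : K) (x : Vertex n lam) :
    M K n lam :=
  if h : ∃ p, IsPathPoly s q x p then h.choose else 0

/-! ### Connected components -/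

/-- A tableau: a filling by nonnegative integers weakly increasing in each row and column. -/
def IsTableau {lam : YoungDiagram} (T : lam.cells → ℕ) : Prop :=
  (∀ c d : lam.cells, c.1.1 = d.1.1 → c.1.2 ≤ d.1.2 → T c ≤ T d) ∧
  (∀ c d : lam.cells, c.1.2 = d.1.2 → c.1.1 ≤ d.1.1 → T c ≤ T d)

/-- Strictly increasing in each row. -/
def IsRowStrict {lam : YoungDiagram} (T : lam.cells → ℕ) : Prop :=
  ∀ c d : lam.cells, c.1.1 = d.1.1 → c.1.2 < d.1.2 → T c < T d

/-- The decreasing rearrangement `v⁺`. -/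
def vplus {n : ℕ} (v : Fin (n + 1) → ℕ) : Fin (n + 1) → ℕ :=
  v ∘ Tuple.sort (OrderDual.toDual ∘ v)

/-- The filling `T(𝕋, v)`: each entry `a` of `𝕋` is replaced by `v⁺[a]`. -/
def filling {n : ℕ} {lam : YoungDiagram} (x : Vertex n lam) : lam.cells → ℕ :=
  fun c => vplus x.2 (x.1.1.symm c)

/-- The vertices of the component `H_T`. -/
def comp (n : ℕ) {lam : YoungDiagram} (T : lam.cells → ℕ) : Set (Vertex n lam) :=
  {x | filling x = T}

instance (n : ℕ) (lam : YoungDiagram) : Finite (RST n lam) :=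
  Finite.of_injective (fun t : RST n lam => t.1) Subtype.val_injective

theorem comp_finite (n : ℕ) {lam : YoungDiagram} (T : lam.cells → ℕ) : (comp n T).Finite := by
  have hsub : comp n T ⊆ (Set.univ : Set (RST n lam)) ×ˢ
      (Set.pi Set.univ fun _ : Fin (n + 1) => Set.Iic (∑ c, T c)) := by
    rintro ⟨t, v⟩ hx
    refine ⟨Set.mem_univ _, fun i _ => ?_⟩
    set σ := Tuple.sort (OrderDual.toDual ∘ v) with hσ
    have h1 : T (t.1 (σ.symm i)) = v i := by
      have hx' : filling (t, v) = T := hx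
      rw [← hx']
      simp [filling, vplus, ← hσ]
    rw [Set.mem_Iic]
    show v i ≤ _
    rw [← h1]
    exact Finset.single_le_sum (f := T) (fun _ _ => Nat.zero_le _) (Finset.mem_univ _)
  exact (Set.finite_univ.prod (Set.Finite.pi' fun _ => Set.finite_Iic _)).subset
    (by simpa [Set.pi] using hsub)

instance (n : ℕ) {lam : YoungDiagram} (T : lam.cells → ℕ) : Fintype (comp n T) :=
  (comp_finite n T).fintype

/-- The space `𝓜_T`, spanned by the `P_ζ` with `ζ ∈ T`. -/
def MT {K : Type*} [Field K] (s q : K) (n : ℕ) {lam : YoungDiagram} (T : lam.cells → ℕ) :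
    Submodule K (M K n lam) :=
  Submodule.span K (macdonald s q '' comp n T)

/-- The antisymmetric polynomials in `𝓜_T`: those with `𝔣 𝐓_i = -𝔣` for all `i`. -/
def antisymmetric {K : Type*} [Field K] (s q : K) (n : ℕ) {lam : YoungDiagram}
    (T : lam.cells → ℕ) : Submodule K (M K n lam) where
  carrier := {f | f ∈ MT s q n T ∧ ∀ i : Fin n, bT s i f = -f}
  add_mem' := by
    rintro f g ⟨hf, hf'⟩ ⟨hg, hg'⟩
    refine ⟨add_mem hf hg, fun i => ?_⟩
    rw [map_add, hf', hg', neg_add]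
  zero_mem' := ⟨zero_mem _, fun i => by simp⟩
  smul_mem' := by
    rintro c f ⟨hf, hf'⟩
    refine ⟨Submodule.smul_mem _ c hf, fun i => ?_⟩
    rw [map_smul, hf', smul_neg]

/-- The root of `H_T`: a vertex of the component that no arrow enters. -/
def IsCompRoot {n : ℕ} {lam : YoungDiagram} (T : lam.cells → ℕ) (x : Vertex n lam) : Prop :=
  x ∈ comp n T ∧ ∀ (i : Fin n) (y : Vertex n lam), ¬ Arrow i y x

/-- The defining conditions of the coefficients `b^a_ζ`, `ζ ∈ T`: the value is `1` at the root, and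
`b^a_{ζ s_i} = - (ζ[i] - ζ[i+1]) / (ζ[i] - s ζ[i+1]) b^a_ζ` if `ζ[i+1] ≻ ζ[i]`. -/
def IsAntisymCoeff {K : Type*} [Field K] (s q : K) {n : ℕ} {lam : YoungDiagram}
    (T : lam.cells → ℕ) (b : comp n T → K) : Prop :=
  (∀ x : comp n T, IsCompRoot T x.1 → b x = 1) ∧
  ∀ (i : Fin n) (x y : comp n T), Arrow i x.1 y.1 →
    b y = -((spec s q x.1 i.castSucc - spec s q x.1 i.succ) /
      (spec s q x.1 i.castSucc - s * spec s q x.1 i.succ)) * b x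

/-- `∑_{ζ ∈ T} b_ζ P_ζ`. -/
def combination {K : Type*} [Field K] (s q : K) {n : ℕ} {lam : YoungDiagram}
    (T : lam.cells → ℕ) (b : comp n T → K) : M K n lam :=
  ∑ x : comp n T, b x • macdonald s q x.1

end VVMac

end

/-!
The nonsymmetric vector valued Macdonald polynomials are compared with a model on which the
operators are explicit. Let `W` be the vector space with basis the vertices of the Yang–Baxter
graph. On `W` the operators `T_i` are defined in seminormal form: `T_i` maps the basis vector of a
vertex `x` to a combination of those of `x` and of `x s_i`, with coefficients depending only on
`ζ[i]` and `ζ[i+1]`; and `Φ` maps the basis vector of a vertex to that of its image under the affine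
action. Rational function identities give the quadratic and braid relations
(`IsGeneric.wT_quadratic`, `IsGeneric.wT_braid`), and the relations between `T_i` and `Φ` hold since
the affine action shifts the spectral vector. In any monoid with these relations the elements
`X_N = Φ T_1 ⋯ T_{N-1}` and `X_i = s T_i⁻¹ X_{i+1} T_i⁻¹` commute (`IsAffineBraid.commute_conjSeq`),
so polynomials act on `W`, and `p ⊗ 𝕋 ↦ p(X) (𝕋, 0)` is a linear map `toModel` from vector valued
polynomials to `W`. By the Bernstein relation (`wT_mul_wEval`) it commutes with `T_i` and `Φ`.

Therefore `toModel` sends the polynomial attached to any path to the basis vector of the endpoint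
(`IsPathPoly.toModel_eq`). Every vertex is the endpoint of a path (`exists_isPathPoly`), so the
Macdonald polynomials are linearly independent; they are homogeneous of degree `|v|`, and comparing
with the number of monomials `x^v ⊗ 𝕋` of each degree shows that they span. Hence `toModel` is
injective (`toModel_injective`), and the problem is moved to `W`.

In `W` the equation `T_i f = -f` says that the coordinates of `f` obey the recursion of the theorem
along the arrows `s_i` and vanish at the vertices whose positions `i`, `i + 1` carry equal values
and neighbouring cells of a row (`IsGeneric.wT_eq_neg_iff`). The recursion is solved by a product
over inversions (`invProd`), and its solutions are determined by the value at the root, because a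
component has one root and every vertex is reached from it (`IsTerminal.eq`, `comp_induction`).
Vertices of the second kind do not exist if `T` is row-strict; otherwise there is one
(`exists_rowNeighbours`), and since the factors of the recursion are nonzero, all coordinates
vanish.
-/

noncomputable section

namespace VVMac

/-! ### Ranks -/

/-- `j` comes before `i` in the order by which `rank v` enumerates the positions: larger values
first, equal values from left to right. -/
def RankBefore {n : ℕ} (v : Fin (n + 1) → ℕ) (j i : Fin (n + 1)) : Prop :=
  (j < i ∧ v i ≤ v j) ∨ (i < j ∧ v i < v j)

theorem rank_val {n : ℕ} (v : Fin (n + 1) → ℕ) (i : Fin (n + 1)) :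
    (rank v i : ℕ) =
      (Finset.univ.filter fun j => (j < i ∧ v i ≤ v j) ∨ (i < j ∧ v i < v j)).card := rfl

/-- Ranks are transported by a permutation of the positions that respects `RankBefore`. -/
theorem rank_eq_of_equiv {n : ℕ} {v w : Fin (n + 1) → ℕ} (e : Equiv.Perm (Fin (n + 1)))
    (i : Fin (n + 1)) (h : ∀ j, RankBefore w j i ↔ RankBefore v (e j) (e i)) :
    rank w i = rank v (e i) := by
  apply Fin.ext
  rw [rank_val, rank_val]
  refine Finset.card_bij (fun j _ => e j) (fun j hj => ?_) (fun _ _ _ _ h => e.injective h)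
    (fun j hj => ⟨e.symm j, ?_, e.apply_symm_apply j⟩)
  · rw [Finset.mem_filter] at hj ⊢
    exact ⟨Finset.mem_univ _, (h j).1 hj.2⟩
  · rw [Finset.mem_filter] at hj ⊢
    refine ⟨Finset.mem_univ _, (h _).2 ?_⟩
    rw [e.apply_symm_apply]
    exact hj.2

theorem rank_lt_rank {n : ℕ} {v : Fin (n + 1) → ℕ} {j i : Fin (n + 1)} (h : RankBefore v j i) :
    rank v j < rank v i := by
  rw [Fin.lt_def, rank_val, rank_val]
  refine Finset.card_lt_card ((Finset.ssubset_iff_of_subset fun k hk => ?_).2 ⟨j, ?_, ?_⟩)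
  · rw [Finset.mem_filter] at hk ⊢
    refine ⟨Finset.mem_univ _, ?_⟩
    have hk := hk.2
    unfold RankBefore at h
    by_cases hki : k = i
    · subst hki
      omega
    · omega
  · rw [Finset.mem_filter]
    exact ⟨Finset.mem_univ _, h⟩
  · simp

theorem rank_injective {n : ℕ} (v : Fin (n + 1) → ℕ) : Function.Injective (rank v) := by
  intro i j hij
  by_contra hne
  have : RankBefore v i j ∨ RankBefore v j i := by
    unfold RankBefore
    rcases lt_or_gt_of_ne hne with l | l <;> rcases lt_trichotomy (v i) (v j) with m | m | m <;>
      omega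
  rcases this with h | h
  · exact (rank_lt_rank h).ne hij
  · exact (rank_lt_rank h).ne hij.symm

theorem rank_bijective {n : ℕ} (v : Fin (n + 1) → ℕ) : Function.Bijective (rank v) :=
  Finite.injective_iff_bijective.1 (rank_injective v)

theorem rank_succ_of_eq {n : ℕ} {v : Fin (n + 1) → ℕ} {i : Fin n}
    (h : v i.castSucc = v i.succ) :
    (rank v i.succ : ℕ) = (rank v i.castSucc : ℕ) + 1 := by
  have hs : (Finset.univ.filter fun j => (j < i.succ ∧ v i.succ ≤ v j) ∨
      (i.succ < j ∧ v i.succ < v j)) =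
      insert i.castSucc (Finset.univ.filter fun j => (j < i.castSucc ∧ v i.castSucc ≤ v j) ∨
        (i.castSucc < j ∧ v i.castSucc < v j)) := by
    ext j
    simp only [Finset.mem_filter, Finset.mem_univ, true_and, Finset.mem_insert]
    rw [← h]
    by_cases h1 : j = i.castSucc
    · subst h1
      simp [Fin.lt_def]
    by_cases h2 : j = i.succ
    · subst h2
      simp [h1, h, Fin.le_def]
    · simp only [Fin.lt_def, Fin.ext_iff, Fin.val_succ, Fin.val_castSucc] at *
      omega
  rw [rank_val, rank_val, hs, Finset.card_insert_of_notMem (by simp)]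

theorem rank_of_antitone {n : ℕ} {v : Fin (n + 1) → ℕ} (h : Antitone v) (i : Fin (n + 1)) :
    rank v i = i := by
  have hm : StrictMono (rank v) := fun a b hab => rank_lt_rank (Or.inl ⟨hab, h hab.le⟩)
  have : rank v = id := by
    refine (StrictMono.range_inj hm strictMono_id).1 ?_
    rw [(rank_bijective v).2.range_eq, Set.range_id]
  exact congrFun this i

theorem rank_zero {n : ℕ} (i : Fin (n + 1)) : rank (0 : Fin (n + 1) → ℕ) i = i :=
  rank_of_antitone (fun _ _ _ => le_rfl) i

theorem rank_comp_swap {n : ℕ} {v : Fin (n + 1) → ℕ} {i : Fin n}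
    (h : v i.castSucc ≠ v i.succ) (k : Fin (n + 1)) :
    rank (v ∘ Equiv.swap i.castSucc i.succ) k =
      rank v (Equiv.swap i.castSucc i.succ k) := by
  refine rank_eq_of_equiv _ _ fun j => ?_
  unfold RankBefore
  simp only [Function.comp_apply]
  have hne : i.castSucc ≠ i.succ := by simp [Fin.ext_iff]
  by_cases a1 : j = i.castSucc
  · by_cases b1 : k = i.castSucc
    · subst a1; subst b1; simp
    by_cases b2 : k = i.succ
    · subst a1; subst b2
      simp only [Equiv.swap_apply_left, Equiv.swap_apply_right, Fin.lt_def, Fin.val_succ,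
        Fin.val_castSucc]
      omega
    · subst a1
      rw [Equiv.swap_apply_left, Equiv.swap_apply_of_ne_of_ne b1 b2]
      simp only [Fin.lt_def, Fin.ext_iff, Fin.val_succ, Fin.val_castSucc] at *
      omega
  by_cases a2 : j = i.succ
  · by_cases b1 : k = i.castSucc
    · subst a2; subst b1
      simp only [Equiv.swap_apply_left, Equiv.swap_apply_right, Fin.lt_def, Fin.val_succ,
        Fin.val_castSucc]
      omega
    by_cases b2 : k = i.succ
    · subst a2; subst b2; simp
    · subst a2
      rw [Equiv.swap_apply_right, Equiv.swap_apply_of_ne_of_ne b1 b2]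
      simp only [Fin.lt_def, Fin.ext_iff, Fin.val_succ, Fin.val_castSucc] at *
      omega
  · rw [Equiv.swap_apply_of_ne_of_ne a1 a2]
    by_cases b1 : k = i.castSucc
    · subst b1
      rw [Equiv.swap_apply_left]
      simp only [Fin.lt_def, Fin.ext_iff, Fin.val_succ, Fin.val_castSucc] at *
      omega
    by_cases b2 : k = i.succ
    · subst b2
      rw [Equiv.swap_apply_right]
      simp only [Fin.lt_def, Fin.ext_iff, Fin.val_succ, Fin.val_castSucc] at *
      omega
    · rw [Equiv.swap_apply_of_ne_of_ne b1 b2]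

theorem affine_castSucc {n : ℕ} (v : Fin (n + 1) → ℕ) (i : Fin n) :
    affine v i.castSucc = v i.succ := by
  simp [affine]

theorem affine_last {n : ℕ} (v : Fin (n + 1) → ℕ) : affine v (Fin.last n) = v 0 + 1 := by
  simp [affine]

theorem finRotate_castSucc {n : ℕ} (i : Fin n) : finRotate (n + 1) i.castSucc = i.succ := by
  rw [finRotate_apply, Fin.coeSucc_eq_succ]

theorem rank_affine {n : ℕ} (v : Fin (n + 1) → ℕ) (k : Fin (n + 1)) :
    rank (affine v) k = rank v (finRotate (n + 1) k) := by
  refine rank_eq_of_equiv _ _ fun j => ?_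
  unfold RankBefore
  induction j using Fin.lastCases with
  | last =>
    induction k using Fin.lastCases with
    | last => simp
    | cast k =>
      rw [finRotate_castSucc, finRotate_last, affine_castSucc, affine_last]
      simp only [Fin.lt_def, Fin.val_succ, Fin.val_castSucc, Fin.val_last, Fin.val_zero]
      omega
  | cast j =>
    induction k using Fin.lastCases with
    | last =>
      rw [finRotate_castSucc, finRotate_last, affine_castSucc, affine_last]
      simp only [Fin.lt_def, Fin.val_succ, Fin.val_castSucc, Fin.val_last, Fin.val_zero]
      omega
    | cast k =>
      simp only [finRotate_castSucc, affine_castSucc, Fin.succ_lt_succ_iff,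
        Fin.castSucc_lt_castSucc_iff]

/-! ### Consecutive entries of a reverse standard tableau -/

/-- Two consecutive entries are neighbours in a row, neighbours in a column, or lie strictly
north-west and south-east of each other. -/
theorem RST.consecutive {n : ℕ} {lam : YoungDiagram} (t : RST n lam) {a b : Fin (n + 1)}
    (hab : (b : ℕ) = a + 1) :
    (t.row b = t.row a ∧ t.col a = t.col b + 1) ∨
    (t.col b = t.col a ∧ t.row a = t.row b + 1) ∨
    (t.row a < t.row b ∧ t.col b < t.col a) ∨ (t.row b < t.row a ∧ t.col a < t.col b) := by
  have hlt : ∀ c d, t.row c ≤ t.row d → t.col c ≤ t.col d → c ≠ d → d < c :=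
    fun c d h1 h2 h => t.2.lt_of_le h1 h2 h
  have hne : a ≠ b := by rintro rfl; omega
  have h1 : ¬ (t.row a ≤ t.row b ∧ t.col a ≤ t.col b) := fun h => by
    have := hlt a b h.1 h.2 hne
    rw [Fin.lt_def] at this
    omega
  have key : ∀ r c : ℕ, t.row b ≤ r → r ≤ t.row a → t.col b ≤ c → c ≤ t.col a →
      (r = t.row b ∧ c = t.col b) ∨ (r = t.row a ∧ c = t.col a) := by
    intro r c h1 h2 h3 h4
    have hm : (r, c) ∈ lam.cells := YoungDiagram.up_left_mem lam h2 h4 (t.1 a).2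
    obtain ⟨d, hd⟩ := t.1.surjective ⟨_, hm⟩
    have hr : t.row d = r := by unfold RST.row; rw [hd]
    have hc : t.col d = c := by unfold RST.col; rw [hd]
    by_cases e1 : d = a
    · subst e1; exact Or.inr ⟨hr.symm, hc.symm⟩
    by_cases e2 : d = b
    · subst e2; exact Or.inl ⟨hr.symm, hc.symm⟩
    have l1 := hlt d a (by omega) (by omega) e1
    have l2 := hlt b d (by omega) (by omega) (Ne.symm e2)
    rw [Fin.lt_def] at l1 l2
    omega
  by_cases h2 : t.row b ≤ t.row a <;> by_cases h3 : t.col b ≤ t.col a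
  · have k1 := key (t.row b) (t.col a) le_rfl h2 h3 le_rfl
    have k2 := key (t.row a) (t.col b) h2 le_rfl le_rfl h3
    by_cases h4 : t.row b + 1 ≤ t.row a
    · have k3 := key (t.row b + 1) (t.col a) (by omega) h4 h3 le_rfl
      omega
    · by_cases h5 : t.col b + 1 ≤ t.col a
      · have k3 := key (t.row a) (t.col b + 1) h2 le_rfl (by omega) h5
        omega
      · omega
  · omega
  · omega
  · omega

/-- Three consecutive entries are never placed around a corner, so the first and the last of
them have different contents. -/
theorem RST.ct_ne_of_two_apart {n : ℕ} {lam : YoungDiagram} (t : RST n lam) {a c : Fin (n + 1)}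
    (hac : (c : ℕ) = a + 2) : t.ct a ≠ t.ct c := by
  have hlt : ∀ c d, t.row c ≤ t.row d → t.col c ≤ t.col d → c ≠ d → d < c :=
    fun c d h1 h2 h => t.2.lt_of_le h1 h2 h
  intro h
  unfold RST.ct at h
  have hne : a ≠ c := by rintro rfl; omega
  have hinj : t.row a = t.row c → t.col a ≠ t.col c := fun e1 e2 =>
    hne (t.1.injective (Subtype.ext (Prod.ext e1 e2)))
  have hnot : ¬ (t.row a ≤ t.row c ∧ t.col a ≤ t.col c) := fun h => by
    have := hlt a c h.1 h.2 hne
    rw [Fin.lt_def] at this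
    omega
  -- both remaining corners of the rectangle spanned by the two cells carry the entry in between
  have key : ∀ r k : ℕ, t.row c ≤ r → r ≤ t.row a → t.col c ≤ k → k ≤ t.col a →
      ((r, k) ≠ (t.row c, t.col c)) → ((r, k) ≠ (t.row a, t.col a)) →
      ∃ d, t.row d = r ∧ t.col d = k ∧ (d : ℕ) = a + 1 := by
    intro r k h1 h2 h3 h4 n1 n2
    have hm : (r, k) ∈ lam.cells := YoungDiagram.up_left_mem lam h2 h4 (t.1 a).2
    obtain ⟨d, hd⟩ := t.1.surjective ⟨_, hm⟩
    have hr : t.row d = r := by unfold RST.row; rw [hd]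
    have hc : t.col d = k := by unfold RST.col; rw [hd]
    refine ⟨d, hr, hc, ?_⟩
    have e1 : d ≠ a := by rintro rfl; exact n2 (Prod.ext hr.symm hc.symm)
    have e2 : d ≠ c := by rintro rfl; exact n1 (Prod.ext hr.symm hc.symm)
    have l1 := hlt d a (by omega) (by omega) e1
    have l2 := hlt c d (by omega) (by omega) (Ne.symm e2)
    rw [Fin.lt_def] at l1 l2
    omega
  have hr : t.row c < t.row a := by
    rcases lt_trichotomy (t.row c) (t.row a) with l | l | l
    · exact l
    · exact absurd (by omega) (hinj l.symm)
    · omega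
  have hk : t.col c < t.col a := by omega
  obtain ⟨d, d1, d2, d3⟩ := key (t.row c) (t.col a) le_rfl hr.le hk.le le_rfl
    (by simp; omega) (by simp; omega)
  obtain ⟨e, e1, e2, e3⟩ := key (t.row a) (t.col c) hr.le le_rfl le_rfl hk.le
    (by simp; omega) (by simp; omega)
  have : d = e := Fin.ext (by omega)
  subst this
  omega

/-! ### Vertices as labelled sequences of cells -/

/-- The cell of `x = (𝕋, v)` attached to the position `i`, that is the cell of the entry `r_v[i]`
of `𝕋`. A vertex is determined by `v` and these cells, and the elementary transpositions and the
affine action permute them like the entries of `v`. -/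
def cellAt {n : ℕ} {lam : YoungDiagram} (x : Vertex n lam) (i : Fin (n + 1)) : lam.cells :=
  x.1.1 (rank x.2 i)

/-- The exponents `(v[i], CT_𝕋[r_v[i]])` of `q` and `s` in the entry `ζ[i]` of the spectral
vector. -/
def label {n : ℕ} {lam : YoungDiagram} (x : Vertex n lam) (i : Fin (n + 1)) : ℕ × ℤ :=
  (x.2 i, x.1.ct (rank x.2 i))

theorem label_eq {n : ℕ} {lam : YoungDiagram} (x : Vertex n lam) (i : Fin (n + 1)) :
    label x i = (x.2 i, ((cellAt x i).1.2 : ℤ) - ((cellAt x i).1.1 : ℤ)) := rfl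

theorem cellAt_bijective {n : ℕ} {lam : YoungDiagram} (x : Vertex n lam) :
    Function.Bijective (cellAt x) := x.1.1.bijective.comp (rank_bijective x.2)

theorem vertex_ext {n : ℕ} {lam : YoungDiagram} {x y : Vertex n lam} (h1 : ∀ i, x.2 i = y.2 i)
    (h2 : ∀ i, cellAt x i = cellAt y i) : x = y := by
  have e2 : x.2 = y.2 := funext h1
  refine Prod.ext (Subtype.ext (Equiv.ext fun a => ?_)) e2
  obtain ⟨i, rfl⟩ := (rank_bijective x.2).2 a
  have := h2 i
  unfold cellAt at this
  rw [this, e2]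

/-- The relation `q^a s^b ≻ q^c s^d` on exponents. -/
def LSucc (a b : ℕ × ℤ) : Prop := b.1 < a.1 ∨ (a.1 = b.1 ∧ a.2 ≤ b.2 - 2)

theorem LSucc.asymm {a b : ℕ × ℤ} (h : LSucc a b) : ¬ LSucc b a := by
  unfold LSucc at *; omega

theorem succ_iff {n : ℕ} {lam : YoungDiagram} (x : Vertex n lam) (j i : Fin (n + 1)) :
    Succ x j i ↔ LSucc (label x j) (label x i) := Iff.rfl

/-- The vertex `x s_i` exists: an arrow labelled `s_i` leaves or enters `x`. -/
def Swappable {n : ℕ} {lam : YoungDiagram} (x : Vertex n lam) (i : Fin n) : Prop :=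
  LSucc (label x i.succ) (label x i.castSucc) ∨ LSucc (label x i.castSucc) (label x i.succ)

/-- If `x s_i` does not exist, the cells at the positions `i`, `i + 1` are neighbours in a row or
in a column. -/
theorem swappable_or {n : ℕ} {lam : YoungDiagram} (x : Vertex n lam) (i : Fin n) :
    Swappable x i ∨ x.2 i.castSucc = x.2 i.succ ∧
      (((cellAt x i.succ).1.1 = (cellAt x i.castSucc).1.1 ∧
        (cellAt x i.castSucc).1.2 = (cellAt x i.succ).1.2 + 1) ∨
      ((cellAt x i.succ).1.2 = (cellAt x i.castSucc).1.2 ∧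
        (cellAt x i.castSucc).1.1 = (cellAt x i.succ).1.1 + 1)) := by
  by_cases h : x.2 i.castSucc = x.2 i.succ
  · unfold Swappable
    rw [label_eq, label_eq]
    unfold LSucc
    have := x.1.consecutive (rank_succ_of_eq h)
    unfold RST.row RST.col at this
    unfold cellAt
    dsimp only
    omega
  · left
    unfold Swappable label LSucc
    dsimp only
    omega

theorem Swappable.cells_ne {n : ℕ} {lam : YoungDiagram} {x : Vertex n lam} {i : Fin n}
    (hx : Swappable x i) (h : x.2 i.castSucc = x.2 i.succ) :
    (cellAt x i.castSucc).1.1 ≠ (cellAt x i.succ).1.1 ∧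
    (cellAt x i.castSucc).1.2 ≠ (cellAt x i.succ).1.2 := by
  unfold Swappable at hx
  rw [label_eq, label_eq] at hx
  unfold LSucc at hx
  have := x.1.consecutive (rank_succ_of_eq h)
  unfold RST.row RST.col at this
  unfold cellAt at *
  dsimp only at hx
  omega

theorem label_ne_succ {n : ℕ} {lam : YoungDiagram} (x : Vertex n lam) (i : Fin n) :
    label x i.castSucc ≠ label x i.succ := by
  intro h
  rcases swappable_or x i with h1 | ⟨-, h1⟩
  · unfold Swappable at h1
    rw [h] at h1
    unfold LSucc at h1
    omega
  · simp only [label_eq, Prod.mk.injEq] at h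
    omega

open Classical in
/-- The vertex `x s_i`; it is `x` itself if exchanging does not give a vertex. -/
def swapV {n : ℕ} {lam : YoungDiagram} (i : Fin n) (x : Vertex n lam) : Vertex n lam :=
  if x.2 i.castSucc = x.2 i.succ then
    if h : IsRST ((Equiv.swap (rank x.2 i.castSucc) (rank x.2 i.succ)).trans x.1.1) then
      (⟨_, h⟩, x.2)
    else x
  else (x.1, x.2 ∘ Equiv.swap i.castSucc i.succ)

theorem Swappable.isRST {n : ℕ} {lam : YoungDiagram} {x : Vertex n lam} {i : Fin n}
    (hx : Swappable x i) (h : x.2 i.castSucc = x.2 i.succ) :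
    IsRST ((Equiv.swap (rank x.2 i.castSucc) (rank x.2 i.succ)).trans x.1.1) := by
  have hr := rank_succ_of_eq h
  have hl := (rank x.2 i.succ).2
  have e1 : (⟨rank x.2 i.castSucc, by omega⟩ : Fin n).castSucc = rank x.2 i.castSucc := rfl
  have e2 : (⟨rank x.2 i.castSucc, by omega⟩ : Fin n).succ = rank x.2 i.succ :=
    Fin.ext hr.symm
  have := x.1.2.swap ⟨rank x.2 i.castSucc, by omega⟩
  rw [e1, e2] at this
  exact this (hx.cells_ne h).1 (hx.cells_ne h).2

theorem isSwap_swapV {n : ℕ} {lam : YoungDiagram} {x : Vertex n lam} {i : Fin n}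
    (hx : Swappable x i) : IsSwap i x (swapV i x) := by
  unfold IsSwap swapV
  by_cases h : x.2 i.castSucc = x.2 i.succ
  · rw [if_pos h, dif_pos (hx.isRST h)]
    exact Or.inr ⟨h, rfl, rfl⟩
  · rw [if_neg h]
    exact Or.inl ⟨h, rfl, rfl⟩

theorem IsSwap.eq_swapV {n : ℕ} {lam : YoungDiagram} {x y : Vertex n lam} {i : Fin n}
    (hy : IsSwap i x y) : y = swapV i x := by
  unfold swapV
  rcases hy with ⟨h, h1, h2⟩ | ⟨h, h2, h1⟩
  · rw [if_neg h]
    exact Prod.ext h1 h2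
  · rw [if_pos h, dif_pos (h1 ▸ y.1.2)]
    exact Prod.ext (Subtype.ext h1) h2

theorem Swappable.swapV_snd {n : ℕ} {lam : YoungDiagram} {x : Vertex n lam} {i : Fin n}
    (hx : Swappable x i) (k : Fin (n + 1)) :
    (swapV i x).2 k = x.2 (Equiv.swap i.castSucc i.succ k) := by
  rcases isSwap_swapV hx with ⟨h, h1, h2⟩ | ⟨h, h2, h1⟩
  · rw [h2]; rfl
  · rw [h2, Equiv.swap_apply_def]
    split_ifs with a b
    · rw [a, h]
    · rw [b, h]
    · rfl

theorem Swappable.cellAt_swapV {n : ℕ} {lam : YoungDiagram} {x : Vertex n lam} {i : Fin n}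
    (hx : Swappable x i) (k : Fin (n + 1)) :
    cellAt (swapV i x) k = cellAt x (Equiv.swap i.castSucc i.succ k) := by
  unfold cellAt
  rcases isSwap_swapV hx with ⟨h, h1, h2⟩ | ⟨h, h2, h1⟩
  · rw [h2, h1, rank_comp_swap h]
  · rw [h2, h1, Equiv.trans_apply, (rank_injective x.2).swap_apply]

theorem Swappable.label_swapV {n : ℕ} {lam : YoungDiagram} {x : Vertex n lam} {i : Fin n}
    (hx : Swappable x i) (k : Fin (n + 1)) :
    label (swapV i x) k = label x (Equiv.swap i.castSucc i.succ k) := by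
  rw [label_eq, label_eq, hx.swapV_snd, hx.cellAt_swapV]

theorem swappable_congr {n : ℕ} {lam : YoungDiagram} {x y : Vertex n lam} {i j : Fin n}
    (hx : Swappable x i) (h1 : label y j.castSucc = label x i.castSucc)
    (h2 : label y j.succ = label x i.succ) : Swappable y j := by
  unfold Swappable; rwa [h1, h2]

theorem Swappable.swapV {n : ℕ} {lam : YoungDiagram} {x : Vertex n lam} {i : Fin n}
    (hx : Swappable x i) : Swappable (swapV i x) i := by
  unfold Swappable
  rw [hx.label_swapV, hx.label_swapV, Equiv.swap_apply_left, Equiv.swap_apply_right]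
  exact Or.symm hx

theorem Swappable.swapV_swapV {n : ℕ} {lam : YoungDiagram} {x : Vertex n lam} {i : Fin n}
    (hx : Swappable x i) : VVMac.swapV i (VVMac.swapV i x) = x :=
  vertex_ext (fun k => by rw [hx.swapV.swapV_snd, hx.swapV_snd, Equiv.swap_apply_self])
    (fun k => by rw [hx.swapV.cellAt_swapV, hx.cellAt_swapV, Equiv.swap_apply_self])

theorem Arrow.swappable {n : ℕ} {lam : YoungDiagram} {x y : Vertex n lam} {i : Fin n}
    (h : Arrow i x y) : Swappable x i := Or.inl h.1

theorem arrow_swapV_of_lSucc {n : ℕ} {lam : YoungDiagram} {x : Vertex n lam} {i : Fin n}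
    (h : LSucc (label x i.succ) (label x i.castSucc)) : Arrow i x (swapV i x) :=
  ⟨h, isSwap_swapV (Or.inl h)⟩

theorem arrow_swapV_self_of_lSucc {n : ℕ} {lam : YoungDiagram} {x : Vertex n lam} {i : Fin n}
    (h : LSucc (label x i.castSucc) (label x i.succ)) : Arrow i (swapV i x) x := by
  have hx : Swappable x i := Or.inr h
  have := arrow_swapV_of_lSucc (x := swapV i x) (i := i) (by
    rwa [hx.label_swapV, hx.label_swapV, Equiv.swap_apply_left, Equiv.swap_apply_right])
  rwa [hx.swapV_swapV] at this

theorem label_ne_two_apart {n : ℕ} {lam : YoungDiagram} (x : Vertex n lam) {i j : Fin n}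
    (hij : (j : ℕ) = i + 1) : label x i.castSucc ≠ label x j.succ := by
  have hj : j.castSucc = i.succ := Fin.ext hij
  by_cases h : Swappable x i
  · -- exchanging brings the two positions next to each other
    have := label_ne_succ (swapV i x) j
    rwa [h.label_swapV, h.label_swapV, hj, Equiv.swap_apply_right,
      Equiv.swap_apply_of_ne_of_ne] at this <;> simp [Fin.ext_iff] <;> omega
  by_cases h' : Swappable x j
  · have := label_ne_succ (swapV j x) i
    rwa [h'.label_swapV, h'.label_swapV, ← hj, Equiv.swap_apply_left,
      Equiv.swap_apply_of_ne_of_ne] at this <;> simp [Fin.ext_iff] <;> omega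
  have e1 := ((swappable_or x i).resolve_left h).1
  have e2 := ((swappable_or x j).resolve_left h').1
  have r1 := rank_succ_of_eq e1
  have r2 := rank_succ_of_eq e2
  rw [hj] at r2
  intro he
  exact x.1.ct_ne_of_two_apart (a := rank x.2 i.castSucc) (c := rank x.2 j.succ) (by omega)
    (congrArg Prod.snd he)

/-! ### The affine action on vertices -/

/-- The affine action on vertices, `(𝕋, v) ↦ (𝕋, vΨ)`. -/
def affineV {n : ℕ} {lam : YoungDiagram} (x : Vertex n lam) : Vertex n lam := (x.1, affine x.2)

theorem cellAt_affineV {n : ℕ} {lam : YoungDiagram} (x : Vertex n lam) (k : Fin (n + 1)) :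
    cellAt (affineV x) k = cellAt x (finRotate (n + 1) k) := by
  unfold cellAt affineV
  rw [rank_affine]

theorem label_affineV_castSucc {n : ℕ} {lam : YoungDiagram} (x : Vertex n lam) (i : Fin n) :
    label (affineV x) i.castSucc = label x i.succ := by
  rw [label_eq, label_eq, cellAt_affineV, finRotate_castSucc]
  exact Prod.ext (affine_castSucc _ _) rfl

theorem label_affineV_last {n : ℕ} {lam : YoungDiagram} (x : Vertex n lam) :
    label (affineV x) (Fin.last n) = label x 0 + (1, 0) := by
  rw [label_eq, label_eq, cellAt_affineV, finRotate_last]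
  exact Prod.ext (affine_last _) (add_zero _).symm

theorem affineV_snd {n : ℕ} {lam : YoungDiagram} (x : Vertex n lam) (k : Fin (n + 1)) :
    (affineV x).2 k = x.2 (finRotate (n + 1) k) + if k = Fin.last n then 1 else 0 := by
  show affine x.2 k = _
  induction k using Fin.lastCases with
  | last => rw [affine_last, finRotate_last, if_pos rfl]
  | cast k => rw [affine_castSucc, finRotate_castSucc, if_neg (by simp [Fin.ext_iff]; omega),
      add_zero]

theorem swapV_affineV {n : ℕ} {lam : YoungDiagram} {x : Vertex n lam} {i j : Fin n}
    (hij : (j : ℕ) = i + 1) (hx : Swappable x j) :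
    swapV i (affineV x) = affineV (swapV j x) := by
  have hj : i.succ = j.castSucc := Fin.ext hij.symm
  have h : Swappable (affineV x) i := by
    refine swappable_congr hx ?_ ?_
    · rw [label_affineV_castSucc, hj]
    · rw [hj, label_affineV_castSucc]
  have hrot : ∀ k, finRotate (n + 1) (Equiv.swap i.castSucc i.succ k) =
      Equiv.swap j.castSucc j.succ (finRotate (n + 1) k) := by
    intro k
    rw [← (finRotate (n + 1)).injective.swap_apply, finRotate_castSucc, hj, finRotate_castSucc]
  have hlast : ∀ k, Equiv.swap i.castSucc i.succ k = Fin.last n ↔ k = Fin.last n := by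
    intro k
    rw [← Equiv.eq_symm_apply, Equiv.symm_swap, Equiv.swap_apply_of_ne_of_ne]
    · simp [Fin.ext_iff]; omega
    · simp [Fin.ext_iff]; omega
  refine vertex_ext (fun k => ?_) (fun k => ?_)
  · rw [h.swapV_snd, affineV_snd, affineV_snd, hx.swapV_snd, hrot]
    simp only [hlast]
  · rw [h.cellAt_swapV, cellAt_affineV, cellAt_affineV, hx.cellAt_swapV, hrot]

/-- Applying the affine action twice carries the positions `1`, `2` to `N - 1`, `N`. -/
theorem swapV_affineV_affineV {n : ℕ} {lam : YoungDiagram} {x : Vertex n lam} {i j : Fin n}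
    (hi : i.succ = Fin.last n) (hj : j.castSucc = 0) (hx : Swappable x j)
    (h : Swappable (affineV (affineV x)) i) :
    swapV i (affineV (affineV x)) = affineV (affineV (swapV j x)) := by
  have hrot : ∀ k, finRotate (n + 1) (finRotate (n + 1) (Equiv.swap i.castSucc i.succ k)) =
      Equiv.swap j.castSucc j.succ (finRotate (n + 1) (finRotate (n + 1) k)) := by
    intro k
    rw [← (finRotate (n + 1)).injective.swap_apply, ← (finRotate (n + 1)).injective.swap_apply,
      finRotate_castSucc, hi, finRotate_last, ← hj, finRotate_castSucc, Equiv.swap_comm]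
  have hl : ∀ k, finRotate (n + 1) k = Fin.last n ↔ k = i.castSucc := by
    intro k
    rw [← hi, ← finRotate_castSucc, (finRotate (n + 1)).apply_eq_iff_eq]
  refine vertex_ext (fun k => ?_) (fun k => ?_)
  · rw [h.swapV_snd, affineV_snd, affineV_snd, affineV_snd, affineV_snd, hx.swapV_snd, hrot]
    simp only [hl]
    have hne : Fin.last n ≠ i.castSucc := by simp [Fin.ext_iff, ← hi]
    rw [hi, add_assoc, add_assoc]
    congr 1
    rw [Equiv.swap_apply_def]
    by_cases k1 : k = i.castSucc
    · simp [k1, hne, hne.symm]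
    · by_cases k2 : k = Fin.last n
      · simp [k2, hne, hne.symm]
      · simp [k1, k2]
  · rw [h.cellAt_swapV, cellAt_affineV, cellAt_affineV, cellAt_affineV, cellAt_affineV,
      hx.cellAt_swapV, hrot]

/-! ### Commuting elements from the braid relations -/

section Braid

variable {A : Type*} [Monoid A]

/-- The elements `Z_0, Z_{m+1} = U_m Z_m U_m`. -/
def conjSeq (U : ℕ → A) (Z : A) : ℕ → A
  | 0 => Z
  | m + 1 => U m * conjSeq U Z m * U m

/-- The braid relations for `U_0, …, U_{n-1}`. -/
structure IsBraid (n : ℕ) (U : ℕ → A) : Prop where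
  braid : ∀ i, i + 1 < n → U i * U (i + 1) * U i = U (i + 1) * U i * U (i + 1)
  comm : ∀ i j, i + 2 ≤ j → j < n → Commute (U i) (U j)

theorem IsBraid.commute {n : ℕ} {U : ℕ → A} (hU : IsBraid n U) {i j : ℕ} (hi : i < n) (hj : j < n)
    (h1 : i ≠ j + 1) (h2 : j ≠ i + 1) : Commute (U i) (U j) := by
  rcases lt_trichotomy i j with h | h | h
  · exact hU.comm i j (by omega) hj
  · rw [h]
  · exact (hU.comm j i (by omega) hi).symm

theorem commute_conjSeq_braid {n : ℕ} {U : ℕ → A} (hU : IsBraid n U) {Z : A}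
    (hZ : ∀ j, 0 < j → j < n → Commute Z (U j)) :
    ∀ i ≤ n, ∀ j < n, j ≠ i → j + 1 ≠ i → Commute (conjSeq U Z i) (U j) := by
  intro i
  induction i using Nat.strong_induction_on with
  | _ i ih =>
    intro hi j hj h1 h2
    match i with
    | 0 => exact hZ j (by omega) hj
    | i + 1 =>
      by_cases h : j + 1 = i
      · subst h
        have hc := ih j (by omega) (by omega) (j + 1) (by omega) (by omega) (by omega)
        have hb := hU.braid j (by omega)
        show U (j + 1) * (U j * conjSeq U Z j * U j) * U (j + 1) * U j =
          U j * (U (j + 1) * (U j * conjSeq U Z j * U j) * U (j + 1))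
        generalize conjSeq U Z j = z at *
        generalize U j = a at *
        generalize U (j + 1) = b at *
        calc b * (a * z * a) * b * a = b * a * z * (a * b * a) := by simp only [mul_assoc]
          _ = b * a * (z * b) * a * b := by rw [hb]; simp only [mul_assoc]
          _ = (b * a * b) * z * a * b := by rw [hc.eq]; simp only [mul_assoc]
          _ = a * (b * (a * z * a) * b) := by rw [← hb]; simp only [mul_assoc]
      · have hc := ih i (by omega) (by omega) j hj (by omega) h
        have hu : Commute (U i) (U j) := hU.commute (by omega) hj (by omega) (by omega)
        exact (hu.mul_left hc).mul_left hu

theorem commute_conjSeq_succ {n : ℕ} {U : ℕ → A} (hU : IsBraid n U) {Z : A}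
    (hZ : ∀ j, 0 < j → j < n → Commute Z (U j))
    (h01 : 0 < n → Commute Z (U 0 * Z * U 0)) :
    ∀ i, i + 1 ≤ n → Commute (conjSeq U Z i) (conjSeq U Z (i + 1)) := by
  intro i
  induction i with
  | zero => exact fun h => h01 (by omega)
  | succ i ih =>
    intro hi
    have hc := commute_conjSeq_braid hU hZ i (by omega) (i + 1) (by omega) (by omega) (by omega)
    have hb := hU.braid i (by omega)
    have h := ih (by omega)
    show (U i * conjSeq U Z i * U i) * (U (i + 1) * (U i * conjSeq U Z i * U i) * U (i + 1)) =
      (U (i + 1) * (U i * conjSeq U Z i * U i) * U (i + 1)) * (U i * conjSeq U Z i * U i)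
    have h' : conjSeq U Z i * (U i * conjSeq U Z i * U i) =
      (U i * conjSeq U Z i * U i) * conjSeq U Z i := h
    generalize conjSeq U Z i = z at *
    generalize U i = b at *
    generalize U (i + 1) = a at *
    -- both sides equal `b a (z b z b) a b`
    calc (b * z * b) * (a * (b * z * b) * a) = b * z * (b * a * b) * z * b * a := by
          simp only [mul_assoc]
      _ = b * (z * a) * b * (a * z) * b * a := by rw [hb]; simp only [mul_assoc]
      _ = b * (a * z) * b * (z * a) * b * a := by rw [hc.eq]
      _ = b * a * z * b * z * (a * b * a) := by simp only [mul_assoc]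
      _ = b * a * (z * (b * z * b)) * a * b := by rw [← hb]; simp only [mul_assoc]
      _ = (b * a * b) * z * b * z * a * b := by rw [h']; simp only [mul_assoc]
      _ = a * b * (a * z) * b * (z * a) * b := by rw [hb]; simp only [mul_assoc]
      _ = a * b * (z * a) * b * (a * z) * b := by rw [hc.eq]
      _ = a * b * z * (a * b * a) * z * b := by simp only [mul_assoc]
      _ = a * (b * z * b) * a * (b * z * b) := by rw [← hb]; simp only [mul_assoc]

theorem commute_conjSeq {n : ℕ} {U : ℕ → A} (hU : IsBraid n U) {Z : A}
    (hZ : ∀ j, 0 < j → j < n → Commute Z (U j))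
    (h01 : 0 < n → Commute Z (U 0 * Z * U 0)) :
    ∀ i ≤ n, ∀ j ≤ n, Commute (conjSeq U Z i) (conjSeq U Z j) := by
  have key : ∀ i j, i < j → j ≤ n → Commute (conjSeq U Z i) (conjSeq U Z j) := by
    intro i j hij
    induction j, hij using Nat.le_induction with
    | base => exact commute_conjSeq_succ hU hZ h01 i
    | succ j hij ih =>
      intro hj
      have hc := commute_conjSeq_braid hU hZ i (by omega) j (by omega) (by omega) (by omega)
      exact (hc.mul_right (ih (by omega))).mul_right hc
  intro i hi j hj
  rcases lt_trichotomy i j with h | h | h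
  · exact key i j h hj
  · rw [h]
  · exact (key j i h hi).symm

/-- The product `T_0 T_1 ⋯ T_{k-1}`. -/
def stairProd (T : ℕ → A) : ℕ → A
  | 0 => 1
  | k + 1 => stairProd T k * T k

theorem IsBraid.commute_stairProd {n : ℕ} {T : ℕ → A} (hT : IsBraid n T) {j k : ℕ} (hj : j < n)
    (hk : k < j) : Commute (T j) (stairProd T k) := by
  induction k with
  | zero => exact Commute.one_right _
  | succ k ih =>
    exact (ih (by omega)).mul_right (hT.comm k j (by omega) hj).symm

theorem IsBraid.mul_stairProd {n : ℕ} {T : ℕ → A} (hT : IsBraid n T) {j k : ℕ} (hk : k ≤ n)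
    (hj : j + 1 < k) : T (j + 1) * stairProd T k = stairProd T k * T j := by
  induction k with
  | zero => omega
  | succ k ih =>
    show T (j + 1) * (stairProd T k * T k) = stairProd T k * T k * T j
    by_cases h : j + 1 < k
    · rw [← mul_assoc, ih (by omega) h, mul_assoc, (hT.comm j k (by omega) (by omega)).eq,
        mul_assoc]
    · obtain rfl : k = j + 1 := by omega
      show T (j + 1) * (stairProd T j * T j * T (j + 1)) = stairProd T j * T j * T (j + 1) * T j
      have hc := hT.commute_stairProd (j := j + 1) (k := j) (by omega) (by omega)
      have hb := hT.braid j (by omega)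
      calc T (j + 1) * (stairProd T j * T j * T (j + 1))
          = T (j + 1) * stairProd T j * T j * T (j + 1) := by simp only [mul_assoc]
        _ = stairProd T j * (T (j + 1) * T j * T (j + 1)) := by rw [hc.eq]; simp only [mul_assoc]
        _ = stairProd T j * T j * T (j + 1) * T j := by rw [← hb]; simp only [mul_assoc]

/-- The relations between the braid generators `T_0, …, T_{n-1}` and the raising element `Φ` of
an affine braid monoid. -/
structure IsAffineBraid (n : ℕ) (T : ℕ → A) (Φ : A) : Prop extends IsBraid n T where
  shift : ∀ i, i + 1 < n → T i * Φ = Φ * T (i + 1)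
  wrap : ∀ m, n = m + 1 → T m * (Φ * Φ) = Φ * Φ * T 0

theorem IsAffineBraid.commute_raise {n : ℕ} {T : ℕ → A} {Φ : A} (h : IsAffineBraid n T Φ) {j : ℕ}
    (hj : j + 1 < n) : Commute (Φ * stairProd T n) (T j) := by
  show Φ * stairProd T n * T j = T j * (Φ * stairProd T n)
  rw [mul_assoc, ← h.mul_stairProd le_rfl hj, ← mul_assoc, ← mul_assoc, h.shift j hj]

theorem IsAffineBraid.stairProd_mul_raise {n : ℕ} {T : ℕ → A} {Φ : A} (h : IsAffineBraid n T Φ)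
    {k : ℕ} (hk : k < n) : stairProd T k * Φ = Φ * stairProd (fun i => T (i + 1)) k := by
  induction k with
  | zero => simp [stairProd]
  | succ k ih =>
    show stairProd T k * T k * Φ = Φ * (stairProd (fun i => T (i + 1)) k * T (k + 1))
    rw [mul_assoc, h.shift k hk, ← mul_assoc, ih (by omega), mul_assoc]

theorem mul_stairProd_succ (T : ℕ → A) (k : ℕ) :
    T 0 * stairProd (fun i => T (i + 1)) k = stairProd T (k + 1) := by
  induction k with
  | zero => simp [stairProd]
  | succ k ih =>
    show T 0 * (stairProd (fun i => T (i + 1)) k * T (k + 1)) = stairProd T (k + 1) * T (k + 1)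
    rw [← mul_assoc, ih]

theorem IsBraid.stairProd_mul_stairProd {n : ℕ} {T : ℕ → A} (hT : IsBraid n T) {k : ℕ}
    (hk : k < n) :
    stairProd (fun i => T (i + 1)) k * stairProd T n = stairProd T n * stairProd T k := by
  induction k with
  | zero => simp [stairProd]
  | succ k ih =>
    show stairProd (fun i => T (i + 1)) k * T (k + 1) * stairProd T n =
      stairProd T n * (stairProd T k * T k)
    rw [mul_assoc, hT.mul_stairProd le_rfl hk, ← mul_assoc, ih (by omega), mul_assoc]

theorem IsAffineBraid.commute_last {m : ℕ} {T : ℕ → A} {Φ : A}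
    (h : IsAffineBraid (m + 1) T Φ) :
    Commute (T m) (Φ * stairProd T m * (Φ * stairProd T m)) := by
  have e : Φ * stairProd T m * (Φ * stairProd T m) =
      Φ * Φ * (stairProd (fun i => T (i + 1)) m * stairProd T m) := by
    calc Φ * stairProd T m * (Φ * stairProd T m) =
        Φ * (stairProd T m * Φ) * stairProd T m := by simp only [mul_assoc]
      _ = _ := by rw [h.stairProd_mul_raise (Nat.lt_succ_self m)]; simp only [mul_assoc]
  show T m * _ = _ * T m
  rw [e]
  calc T m * (Φ * Φ * (stairProd (fun i => T (i + 1)) m * stairProd T m))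
      = T m * (Φ * Φ) * stairProd (fun i => T (i + 1)) m * stairProd T m := by
        simp only [mul_assoc]
    _ = Φ * Φ * (T 0 * stairProd (fun i => T (i + 1)) m) * stairProd T m := by
        rw [h.wrap m rfl]; simp only [mul_assoc]
    _ = Φ * Φ * (stairProd T (m + 1) * stairProd T m) := by
        rw [mul_stairProd_succ]; simp only [mul_assoc]
    _ = Φ * Φ * (stairProd (fun i => T (i + 1)) m * stairProd T (m + 1)) := by
        rw [h.stairProd_mul_stairProd (Nat.lt_succ_self m)]
    _ = _ := by
        show _ * (_ * (stairProd T m * T m)) = _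
        simp only [mul_assoc]

theorem IsBraid.reverse {n : ℕ} {T : ℕ → A} (hT : IsBraid n T) :
    IsBraid n fun i => T (n - 1 - i) where
  braid i hi := by
    have := hT.braid (n - 1 - (i + 1)) (by omega)
    rw [show n - 1 - (i + 1) + 1 = n - 1 - i by omega] at this
    exact this.symm
  comm i j hij hj := (hT.comm (n - 1 - j) (n - 1 - i) (by omega) (by omega)).symm

theorem IsBraid.inv {n : ℕ} {T : ℕ → Aˣ} (hT : IsBraid n fun i => (T i : A)) :
    IsBraid n fun i => ((T i)⁻¹.1 : A) where
  braid i hi := by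
    have := hT.braid i hi
    have h : T i * T (i + 1) * T i = T (i + 1) * T i * T (i + 1) := Units.ext (by simpa using this)
    have := congrArg (fun u : Aˣ => ((u⁻¹ : Aˣ) : A)) h
    simpa [mul_assoc] using this
  comm i j hij hj := by
    have := hT.comm i j hij hj
    have h : T i * T j = T j * T i := Units.ext (by simpa using this.eq)
    have := congrArg (fun u : Aˣ => ((u⁻¹ : Aˣ) : A)) h
    show _ * _ = _ * _
    simpa using this.symm

/-- In an affine braid monoid the elements `Z_0 = Φ T_0 ⋯ T_{n-1}`, `Z_{m+1} = T⁻¹ Z_m T⁻¹` with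
`T = T_{n-1-m}` commute. -/
theorem IsAffineBraid.commute_conjSeq {n : ℕ} {T : ℕ → Aˣ} {Φ : A}
    (h : IsAffineBraid n (fun i => (T i : A)) Φ) {i j : ℕ} (hi : i ≤ n) (hj : j ≤ n) :
    Commute (conjSeq (fun i => ((T (n - 1 - i))⁻¹.1 : A)) (Φ * stairProd (fun i => (T i : A)) n) i)
      (conjSeq (fun i => ((T (n - 1 - i))⁻¹.1 : A)) (Φ * stairProd (fun i => (T i : A)) n) j) := by
  refine VVMac.commute_conjSeq (n := n) h.toIsBraid.inv.reverse (fun k hk hkn => ?_)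
    (fun hn => ?_) i hi j hj
  · exact (h.commute_raise (j := n - 1 - k) (by omega)).units_inv_right
  · obtain ⟨m, rfl⟩ : ∃ m, n = m + 1 := ⟨n - 1, by omega⟩
    have hl := h.commute_last
    simp only [Nat.add_sub_cancel, Nat.sub_zero, stairProd]
    generalize stairProd (fun i => (T i : A)) m = C at *
    have h1 : ((T m)⁻¹.1 : A) * (Φ * (C * T m)) * ((T m)⁻¹.1 : A) = ((T m)⁻¹.1 : A) * (Φ * C) := by
      rw [mul_assoc, mul_assoc, mul_assoc, Units.mul_inv, mul_one]
    show _ * _ = _ * _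
    rw [h1]
    have h2 : Φ * (C * T m) * (((T m)⁻¹.1 : A) * (Φ * C)) = Φ * C * (Φ * C) := by
      rw [← mul_assoc Φ, mul_assoc (Φ * C), Units.mul_inv_cancel_left]
    rw [h2]
    have h3 := hl.units_inv_left.eq
    calc Φ * C * (Φ * C) = Φ * C * (Φ * C) * ((T m)⁻¹.1 : A) * T m := by
          rw [mul_assoc _ ((T m)⁻¹.1 : A), Units.inv_mul, mul_one]
      _ = _ := by rw [← h3]; simp only [mul_assoc]

end Braid

/-! ### Coefficients of the Hecke operators -/

/-- The monomials `q^a s^b`, `a ∈ ℕ`, `b ∈ ℤ`, are pairwise distinct. -/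
structure IsGeneric {K : Type*} [Field K] (s q : K) : Prop where
  s_ne_zero : s ≠ 0
  q_ne_zero : q ≠ 0
  eq_of_eq : ∀ (a c : ℕ) (b d : ℤ), q ^ a * s ^ b = q ^ c * s ^ d → a = c ∧ b = d

theorem isGeneric_of_algebraicIndependent {K : Type*} [Field K] [CharZero K] {s q : K}
    (hsq : AlgebraicIndependent ℚ ![s, q]) : IsGeneric s q := by
  have hs : s ≠ 0 := hsq.ne_zero 0
  have hq : q ≠ 0 := hsq.ne_zero 1
  refine ⟨hs, hq, fun a c b d h => ?_⟩
  have key : ∀ (a c b d : ℕ), q ^ a * s ^ b = q ^ c * s ^ d → a = c ∧ b = d := by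
    intro a c b d h
    have h2 : MvPolynomial.aeval ![s, q]
        (MvPolynomial.X 1 ^ a * MvPolynomial.X 0 ^ b : MvPolynomial (Fin 2) ℚ) =
        MvPolynomial.aeval ![s, q]
        (MvPolynomial.X 1 ^ c * MvPolynomial.X 0 ^ d : MvPolynomial (Fin 2) ℚ) := by
      simpa using h
    have h3 := hsq h2
    simp only [MvPolynomial.X_pow_eq_monomial, MvPolynomial.monomial_mul, mul_one] at h3
    have h4 := MvPolynomial.monomial_left_injective (one_ne_zero) h3
    have h5 := DFunLike.congr_fun h4 0
    have h6 := DFunLike.congr_fun h4 1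
    simp at h5 h6
    exact ⟨h6, h5⟩
  have hb : q ^ a * s ^ (b + (|b| + |d|)) = q ^ c * s ^ (d + (|b| + |d|)) := by
    rw [zpow_add₀ hs b, zpow_add₀ hs d, ← mul_assoc, ← mul_assoc, h]
  have b0 : 0 ≤ b + (|b| + |d|) := by have := neg_abs_le b; have := abs_nonneg d; omega
  have d0 : 0 ≤ d + (|b| + |d|) := by have := neg_abs_le d; have := abs_nonneg b; omega
  obtain ⟨b', hb'⟩ := Int.eq_ofNat_of_zero_le b0
  obtain ⟨d', hd'⟩ := Int.eq_ofNat_of_zero_le d0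
  rw [hb', hd', zpow_natCast, zpow_natCast] at hb
  have := key _ _ _ _ hb
  omega

section Coefficients

variable {K : Type*} [Field K]

/-- The monomial `q^a s^b` of a pair of exponents. -/
def zeta (s q : K) (a : ℕ × ℤ) : K := q ^ a.1 * s ^ a.2

theorem spec_eq_zeta {n : ℕ} {lam : YoungDiagram} (s q : K) (x : Vertex n lam) (i : Fin (n + 1)) :
    spec s q x i = zeta s q (label x i) := rfl

/-- The diagonal coefficient of the Hecke operator at a position with spectral entries
`a`, `b`. -/
def diagCoeff (s q : K) (a b : ℕ × ℤ) : K := -((1 - s) / (1 - zeta s q b / zeta s q a))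

open Classical in
/-- The coefficient of the exchanged vertex in the image of a vertex with spectral entries `a`,
`b`. -/
def swapCoeff (s q : K) (a b : ℕ × ℤ) : K :=
  if LSucc b a then 1
  else if LSucc a b then
    s * (1 - zeta s q b / zeta s q a * s) * (1 - zeta s q b / zeta s q a * s⁻¹) /
      (1 - zeta s q b / zeta s q a) ^ 2
  else 0

variable {s q : K}

theorem IsGeneric.zeta_ne_zero (h : IsGeneric s q) (a : ℕ × ℤ) : zeta s q a ≠ 0 :=
  mul_ne_zero (pow_ne_zero _ h.q_ne_zero) (zpow_ne_zero _ h.s_ne_zero)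

theorem IsGeneric.zeta_injective (h : IsGeneric s q) : Function.Injective (zeta s q) :=
  fun _ _ hab => Prod.ext (h.eq_of_eq _ _ _ _ hab).1 (h.eq_of_eq _ _ _ _ hab).2

theorem IsGeneric.s_mul_zeta (h : IsGeneric s q) (a : ℕ × ℤ) :
    s * zeta s q a = zeta s q (a.1, a.2 + 1) := by
  unfold zeta
  rw [zpow_add_one₀ h.s_ne_zero]
  ring

theorem zeta_add_shift (a : ℕ × ℤ) : zeta s q (a + (1, 0)) = q * zeta s q a := by
  unfold zeta
  simp only [Prod.fst_add, Prod.snd_add, add_zero, pow_succ]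
  ring

theorem IsGeneric.zeta_add_div (h : IsGeneric s q) (a b : ℕ × ℤ) :
    zeta s q (b + (1, 0)) / zeta s q (a + (1, 0)) = zeta s q b / zeta s q a := by
  rw [zeta_add_shift, zeta_add_shift, mul_div_mul_left _ _ h.q_ne_zero]

theorem IsGeneric.diagCoeff_add (h : IsGeneric s q) (a b : ℕ × ℤ) :
    diagCoeff s q (a + (1, 0)) (b + (1, 0)) = diagCoeff s q a b := by
  unfold diagCoeff; rw [h.zeta_add_div]

theorem lSucc_add (a b : ℕ × ℤ) : LSucc (a + (1, 0)) (b + (1, 0)) ↔ LSucc a b := by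
  unfold LSucc
  simp only [Prod.fst_add, Prod.snd_add]
  omega

theorem IsGeneric.swapCoeff_add (h : IsGeneric s q) (a b : ℕ × ℤ) :
    swapCoeff s q (a + (1, 0)) (b + (1, 0)) = swapCoeff s q a b := by
  unfold swapCoeff
  rw [h.zeta_add_div, propext (lSucc_add a b), propext (lSucc_add b a)]

theorem IsGeneric.diagCoeff_eq (h : IsGeneric s q) (a b : ℕ × ℤ) :
    diagCoeff s q a b = -((1 - s) * zeta s q a / (zeta s q a - zeta s q b)) := by
  have ha := h.zeta_ne_zero a
  unfold diagCoeff
  rw [one_sub_div ha, div_div_eq_mul_div]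

theorem swapCoeff_eq_zero {a b : ℕ × ℤ} (h : ¬ (LSucc b a ∨ LSucc a b)) :
    swapCoeff s q a b = 0 := by
  unfold swapCoeff
  rw [if_neg (fun h' => h (Or.inl h')), if_neg (fun h' => h (Or.inr h'))]

/-- Two labels which are comparable, or which differ by one in the exponent of `s` only. -/
def Interacting (a b : ℕ × ℤ) : Prop :=
  LSucc b a ∨ LSucc a b ∨ (a.1 = b.1 ∧ (a.2 = b.2 + 1 ∨ b.2 = a.2 + 1))

theorem Interacting.ne {a b : ℕ × ℤ} (h : Interacting a b) : a ≠ b := by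
  rintro rfl
  unfold Interacting LSucc at h
  omega

theorem IsGeneric.sub_ne_zero (h : IsGeneric s q) {a b : ℕ × ℤ} (hab : a ≠ b) :
    zeta s q a - zeta s q b ≠ 0 := _root_.sub_ne_zero.2 fun e => hab (h.zeta_injective e)

/-- The right-hand side vanishes for labels that differ by one in the exponent of `s` only, so the
formula also covers the pairs that cannot be exchanged. -/
theorem IsGeneric.swapCoeff_mul_swapCoeff (h : IsGeneric s q) {a b : ℕ × ℤ}
    (hab : Interacting a b) :
    swapCoeff s q a b * swapCoeff s q b a =
      (s * zeta s q a - zeta s q b) * (zeta s q a - s * zeta s q b) /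
        (zeta s q a - zeta s q b) ^ 2 := by
  have ha := h.zeta_ne_zero a
  have hb := h.zeta_ne_zero b
  have hs := h.s_ne_zero
  have hd := h.sub_ne_zero hab.ne
  have hd' := h.sub_ne_zero hab.ne.symm
  unfold swapCoeff
  rcases hab with h1 | h1 | h1
  · rw [if_pos h1, if_neg h1.asymm, if_pos h1, one_sub_div hb]
    field_simp
    ring
  · rw [if_neg h1.asymm, if_pos h1, if_pos h1, one_sub_div ha]
    field_simp
  · have n1 : ¬ LSucc a b := by unfold LSucc; omega
    have n2 : ¬ LSucc b a := by unfold LSucc; omega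
    rw [if_neg n1, if_neg n2, if_neg n1, zero_mul]
    symm
    rw [div_eq_zero_iff]
    left
    rcases h1.2 with h2 | h2
    · rw [h.s_mul_zeta b, show (b.1, b.2 + 1) = a from Prod.ext h1.1.symm h2.symm, sub_self,
        mul_zero]
    · rw [h.s_mul_zeta a, show (a.1, a.2 + 1) = b from Prod.ext h1.1 h2.symm, sub_self,
        zero_mul]

/-- The diagonal entry of the quadratic relation. -/
theorem IsGeneric.quadratic_diag (h : IsGeneric s q) {a b : ℕ × ℤ} (hab : Interacting a b) :
    diagCoeff s q a b * diagCoeff s q a b + swapCoeff s q a b * swapCoeff s q b a =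
      (s - 1) * diagCoeff s q a b + s := by
  have hd := h.sub_ne_zero hab.ne
  rw [h.swapCoeff_mul_swapCoeff hab, h.diagCoeff_eq]
  field_simp
  ring

theorem IsGeneric.diagCoeff_add_diagCoeff (h : IsGeneric s q) {a b : ℕ × ℤ} (hab : a ≠ b) :
    diagCoeff s q a b + diagCoeff s q b a = s - 1 := by
  have hd := h.sub_ne_zero hab
  rw [h.diagCoeff_eq, h.diagCoeff_eq, ← neg_sub (zeta s q a) (zeta s q b)]
  field_simp
  ring

/-- The entry of the braid relation at the vertex obtained by exchanging `a` and `b`. -/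
theorem IsGeneric.diagCoeff_braid (h : IsGeneric s q) {a b c : ℕ × ℤ} (hab : a ≠ b)
    (hac : a ≠ c) (hbc : b ≠ c) :
    diagCoeff s q a b * diagCoeff s q b c + diagCoeff s q b a * diagCoeff s q a c =
      diagCoeff s q a c * diagCoeff s q b c := by
  have h1 := h.sub_ne_zero hab
  have h2 := h.sub_ne_zero hac
  have h3 := h.sub_ne_zero hbc
  rw [h.diagCoeff_eq, h.diagCoeff_eq, h.diagCoeff_eq, h.diagCoeff_eq,
    ← neg_sub (zeta s q a) (zeta s q b)]
  field_simp
  ring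

/-- The entry of the braid relation at the vertex obtained by exchanging `b` and `c`. -/
theorem IsGeneric.diagCoeff_braid' (h : IsGeneric s q) {a b c : ℕ × ℤ} (hab : a ≠ b)
    (hac : a ≠ c) (hbc : b ≠ c) :
    diagCoeff s q b c * diagCoeff s q a b + diagCoeff s q c b * diagCoeff s q a c =
      diagCoeff s q a c * diagCoeff s q a b := by
  have h1 := h.sub_ne_zero hab
  have h2 := h.sub_ne_zero hac
  have h3 := h.sub_ne_zero hbc
  rw [h.diagCoeff_eq, h.diagCoeff_eq, h.diagCoeff_eq, h.diagCoeff_eq,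
    ← neg_sub (zeta s q b) (zeta s q c)]
  field_simp
  ring

/-- The diagonal entry of the braid relation. -/
theorem IsGeneric.quadratic_braid (h : IsGeneric s q) {a b c : ℕ × ℤ} (hab : Interacting a b)
    (hac : a ≠ c) (hbc : Interacting b c) :
    diagCoeff s q a b * diagCoeff s q b c * diagCoeff s q a b +
      swapCoeff s q a b * swapCoeff s q b a * diagCoeff s q a c =
    diagCoeff s q b c * diagCoeff s q a b * diagCoeff s q b c +
      swapCoeff s q b c * swapCoeff s q c b * diagCoeff s q a c := by
  have h1 := h.sub_ne_zero hab.ne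
  have h2 := h.sub_ne_zero hac
  have h3 := h.sub_ne_zero hbc.ne
  rw [h.swapCoeff_mul_swapCoeff hab, h.swapCoeff_mul_swapCoeff hbc, h.diagCoeff_eq,
    h.diagCoeff_eq, h.diagCoeff_eq]
  field_simp
  ring

end Coefficients

theorem interacting_succ {n : ℕ} {lam : YoungDiagram} (x : Vertex n lam) (i : Fin n) :
    Interacting (label x i.castSucc) (label x i.succ) := by
  rcases swappable_or x i with h | h
  · unfold Swappable at h
    unfold Interacting
    tauto
  · right; right
    rw [label_eq, label_eq]
    dsimp only
    omega

/-! ### The model: a module with basis the vertices -/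

section Model

variable {K : Type*} [Field K] {n : ℕ} {lam : YoungDiagram}

/-- The vector space with basis the vertices of the Yang–Baxter graph. -/
abbrev W (K : Type*) [Field K] (n : ℕ) (lam : YoungDiagram) : Type _ := Vertex n lam →₀ K

/-- The basis vector of a vertex. -/
abbrev bas (K : Type*) [Field K] {n : ℕ} {lam : YoungDiagram} (x : Vertex n lam) : W K n lam :=
  Finsupp.single x 1

/-- The Hecke operator `T_i` on the model, in seminormal form. -/
def wT (s q : K) (i : Fin n) : Module.End K (W K n lam) :=
  Finsupp.linearCombination K fun x =>
    diagCoeff s q (label x i.castSucc) (label x i.succ) • bas K x +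
      swapCoeff s q (label x i.castSucc) (label x i.succ) • bas K (swapV i x)

/-- The raising operator on the model. -/
def wPhi : Module.End K (W K n lam) := Finsupp.lmapDomain K K affineV

theorem wT_bas (s q : K) (i : Fin n) (x : Vertex n lam) :
    wT s q i (bas K x) = diagCoeff s q (label x i.castSucc) (label x i.succ) • bas K x +
      swapCoeff s q (label x i.castSucc) (label x i.succ) • bas K (swapV i x) := by
  simp [wT]

theorem wPhi_bas (x : Vertex n lam) : wPhi (bas K x) = bas K (affineV x) := by
  simp [wPhi]

theorem W_hom_ext {f g : Module.End K (W K n lam)} (h : ∀ x, f (bas K x) = g (bas K x)) :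
    f = g := Finsupp.lhom_ext' fun x => LinearMap.ext_ring (h x)

variable {s q : K}

/-- `T_j` on an exchanged vertex, multiplied by the coefficient with which that vertex occurs. -/
theorem swapCoeff_smul_wT (i j : Fin n) (x : Vertex n lam) {a b c d : ℕ × ℤ}
    (ha : label x i.castSucc = a) (hb : label x i.succ = b)
    (hc : label x (Equiv.swap i.castSucc i.succ j.castSucc) = c)
    (hd : label x (Equiv.swap i.castSucc i.succ j.succ) = d) :
    swapCoeff s q a b • wT s q j (bas K (swapV i x)) =
      swapCoeff s q a b • (diagCoeff s q c d • bas K (swapV i x) +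
        swapCoeff s q c d • bas K (swapV j (swapV i x))) := by
  by_cases h : Swappable x i
  · rw [wT_bas, h.label_swapV, h.label_swapV, hc, hd]
  · subst ha hb
    rw [swapCoeff_eq_zero h, zero_smul, zero_smul]

/-- The analogue of `swapCoeff_smul_wT` for a vertex obtained by two exchanges. -/
theorem swapCoeff_mul_smul_wT (i j k : Fin n) (x : Vertex n lam) {a b c d e f : ℕ × ℤ}
    (ha : label x i.castSucc = a) (hb : label x i.succ = b)
    (hc : label x (Equiv.swap i.castSucc i.succ j.castSucc) = c)
    (hd : label x (Equiv.swap i.castSucc i.succ j.succ) = d)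
    (he : label x (Equiv.swap i.castSucc i.succ (Equiv.swap j.castSucc j.succ k.castSucc)) = e)
    (hf : label x (Equiv.swap i.castSucc i.succ (Equiv.swap j.castSucc j.succ k.succ)) = f) :
    (swapCoeff s q a b * swapCoeff s q c d) • wT s q k (bas K (swapV j (swapV i x))) =
      (swapCoeff s q a b * swapCoeff s q c d) •
        (diagCoeff s q e f • bas K (swapV j (swapV i x)) +
          swapCoeff s q e f • bas K (swapV k (swapV j (swapV i x)))) := by
  by_cases h : Swappable x i
  · rw [mul_smul, mul_smul, swapCoeff_smul_wT j k (swapV i x) (c := e) (d := f)] <;>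
      rwa [h.label_swapV]
  · subst ha hb
    rw [swapCoeff_eq_zero h, zero_mul, zero_smul, zero_smul]

theorem swapCoeff_smul_swapV_swapV (i : Fin n) (x : Vertex n lam) :
    swapCoeff s q (label x i.castSucc) (label x i.succ) • bas K (swapV i (swapV i x)) =
      swapCoeff s q (label x i.castSucc) (label x i.succ) • bas K x := by
  by_cases h : Swappable x i
  · rw [h.swapV_swapV]
  · rw [swapCoeff_eq_zero h, zero_smul, zero_smul]

theorem IsGeneric.wT_quadratic (h : IsGeneric s q) (i : Fin n) :
    wT (lam := lam) s q i * wT s q i = (s - 1) • wT s q i + s • 1 := by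
  refine W_hom_ext fun x => ?_
  have hi := interacting_succ x i
  have h1 := swapCoeff_smul_wT (s := s) (q := q) i i x rfl rfl rfl rfl
  have h2 := swapCoeff_smul_swapV_swapV (s := s) (q := q) i x
  have h3 := wT_bas s q i x
  rw [Equiv.swap_apply_left, Equiv.swap_apply_right] at h1
  have e1 := h.quadratic_diag hi
  have e2 := h.diagCoeff_add_diagCoeff hi.ne
  simp only [Module.End.mul_apply, LinearMap.add_apply, LinearMap.smul_apply,
    Module.End.one_apply]
  generalize label x i.castSucc = a at *
  generalize label x i.succ = b at *
  rw [h3, map_add, map_smul, map_smul, h3]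
  linear_combination (norm := module) h1 + swapCoeff s q b a • h2 +
    e1 • bas K x + (swapCoeff s q a b * e2) • bas K (swapV i x)

theorem IsGeneric.wT_comm (i j : Fin n) (hij : (i : ℕ) + 2 ≤ j) :
    wT (lam := lam) s q i * wT s q j = wT s q j * wT s q i := by
  refine W_hom_ext fun x => ?_
  have n1 : j.castSucc ≠ i.castSucc := by simp [Fin.ext_iff]; omega
  have n2 : j.castSucc ≠ i.succ := by simp [Fin.ext_iff]; omega
  have n3 : j.succ ≠ i.castSucc := by simp [Fin.ext_iff]; omega
  have n4 : j.succ ≠ i.succ := by simp [Fin.ext_iff]; omega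
  have k1 : Equiv.swap i.castSucc i.succ j.castSucc = j.castSucc :=
    Equiv.swap_apply_of_ne_of_ne n1 n2
  have k2 : Equiv.swap i.castSucc i.succ j.succ = j.succ :=
    Equiv.swap_apply_of_ne_of_ne n3 n4
  have k3 : Equiv.swap j.castSucc j.succ i.castSucc = i.castSucc :=
    Equiv.swap_apply_of_ne_of_ne n1.symm n3.symm
  have k4 : Equiv.swap j.castSucc j.succ i.succ = i.succ :=
    Equiv.swap_apply_of_ne_of_ne n2.symm n4.symm
  have h1 := swapCoeff_smul_wT (s := s) (q := q) i j x rfl rfl rfl rfl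
  have h2 := swapCoeff_smul_wT (s := s) (q := q) j i x rfl rfl rfl rfl
  rw [k1, k2] at h1
  rw [k3, k4] at h2
  have h3 : (swapCoeff s q (label x i.castSucc) (label x i.succ) *
      swapCoeff s q (label x j.castSucc) (label x j.succ)) • bas K (swapV j (swapV i x)) =
      (swapCoeff s q (label x i.castSucc) (label x i.succ) *
      swapCoeff s q (label x j.castSucc) (label x j.succ)) • bas K (swapV i (swapV j x)) := by
    by_cases hi : Swappable x i
    · by_cases hj : Swappable x j
      · have hi' : Swappable (swapV j x) i := swappable_congr hi
          (by rw [hj.label_swapV, k3]) (by rw [hj.label_swapV, k4])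
        have hj' : Swappable (swapV i x) j := swappable_congr hj
          (by rw [hi.label_swapV, k1]) (by rw [hi.label_swapV, k2])
        have hc : ∀ k, Equiv.swap i.castSucc i.succ (Equiv.swap j.castSucc j.succ k) =
            Equiv.swap j.castSucc j.succ (Equiv.swap i.castSucc i.succ k) := by
          intro k
          have := (Equiv.swap i.castSucc i.succ).injective.swap_apply j.castSucc j.succ k
          rw [k1, k2] at this
          exact this.symm
        congr 2
        exact vertex_ext
          (fun k => by rw [hj'.swapV_snd, hi.swapV_snd, hi'.swapV_snd, hj.swapV_snd, hc])
          (fun k => by rw [hj'.cellAt_swapV, hi.cellAt_swapV, hi'.cellAt_swapV,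
            hj.cellAt_swapV, hc])
      · rw [swapCoeff_eq_zero hj, mul_zero, zero_smul, zero_smul]
    · rw [swapCoeff_eq_zero hi, zero_mul, zero_smul, zero_smul]
  have hi := wT_bas s q i x
  have hj := wT_bas s q j x
  simp only [Module.End.mul_apply]
  rw [hi, hj, map_add, map_smul, map_smul, map_add, map_smul, map_smul, hi, hj]
  linear_combination (norm := module) h2 - h1 - h3

theorem swap_braid {α : Type*} [DecidableEq α] {a b c : α} (hab : a ≠ b) (hac : a ≠ c)
    (hbc : b ≠ c) (k : α) :
    Equiv.swap a b (Equiv.swap b c (Equiv.swap a b k)) =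
      Equiv.swap b c (Equiv.swap a b (Equiv.swap b c k)) := by
  have h1 := Equiv.swap_mul_swap_mul_swap (x := a) (y := b) (z := c) hab hac
  have h2 := Equiv.swap_mul_swap_mul_swap (x := c) (y := b) (z := a) hbc.symm hac.symm
  rw [Equiv.swap_comm b a, Equiv.swap_comm c b, Equiv.swap_comm a c] at h2
  exact DFunLike.congr_fun (h2.trans h1.symm) k

theorem IsGeneric.wT_braid (h : IsGeneric s q) (i j : Fin n) (hij : (j : ℕ) = i + 1) :
    wT (lam := lam) s q i * wT s q j * wT s q i = wT s q j * wT s q i * wT s q j := by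
  refine W_hom_ext fun x => ?_
  have hj : j.castSucc = i.succ := Fin.ext hij
  have n1 : i.castSucc ≠ i.succ := by simp [Fin.ext_iff]
  have n2 : i.castSucc ≠ j.succ := by simp [Fin.ext_iff]; omega
  have n3 : i.succ ≠ j.succ := by simp [Fin.ext_iff]; omega
  have k1 : Equiv.swap i.castSucc i.succ j.succ = j.succ :=
    Equiv.swap_apply_of_ne_of_ne n2.symm n3.symm
  have k2 : Equiv.swap i.succ j.succ i.castSucc = i.castSucc :=
    Equiv.swap_apply_of_ne_of_ne n1 n2
  have hab := interacting_succ x i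
  have hbc := interacting_succ x j
  have hac := label_ne_two_apart x hij
  have h0i := wT_bas s q i x
  have h0j := wT_bas s q j x
  have hii := swapCoeff_smul_wT (s := s) (q := q) i i x rfl rfl rfl rfl
  have hij := swapCoeff_smul_wT (s := s) (q := q) i j x rfl rfl rfl rfl
  have hji := swapCoeff_smul_wT (s := s) (q := q) j i x rfl rfl rfl rfl
  have hjj := swapCoeff_smul_wT (s := s) (q := q) j j x rfl rfl rfl rfl
  have hiji := swapCoeff_mul_smul_wT (s := s) (q := q) i j i x rfl rfl rfl rfl rfl rfl
  have hjij := swapCoeff_mul_smul_wT (s := s) (q := q) j i j x rfl rfl rfl rfl rfl rfl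
  have hi2 := swapCoeff_smul_swapV_swapV (s := s) (q := q) i x
  have hj2 := swapCoeff_smul_swapV_swapV (s := s) (q := q) j x
  rw [hj] at hbc h0j hij hji hjj hiji hjij hj2
  simp only [Equiv.swap_apply_left, Equiv.swap_apply_right, k1, k2] at hii hij hji hjj hiji hjij
  have hlong : (swapCoeff s q (label x i.castSucc) (label x i.succ) *
      swapCoeff s q (label x i.castSucc) (label x j.succ) *
      swapCoeff s q (label x i.succ) (label x j.succ)) • bas K (swapV i (swapV j (swapV i x))) =
      (swapCoeff s q (label x i.castSucc) (label x i.succ) *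
      swapCoeff s q (label x i.castSucc) (label x j.succ) *
      swapCoeff s q (label x i.succ) (label x j.succ)) •
        bas K (swapV j (swapV i (swapV j x))) := by
    by_cases s1 : Swappable x i
    swap
    · rw [swapCoeff_eq_zero s1, zero_mul, zero_mul, zero_smul, zero_smul]
    by_cases s2 : Swappable x j
    swap
    · unfold Swappable at s2
      rw [hj] at s2
      rw [swapCoeff_eq_zero s2, mul_zero, zero_smul, zero_smul]
    by_cases s3 : Swappable (swapV i x) j
    swap
    · unfold Swappable at s3
      rw [s1.label_swapV, s1.label_swapV, hj, Equiv.swap_apply_right, k1] at s3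
      rw [swapCoeff_eq_zero s3, mul_zero, zero_mul, zero_smul, zero_smul]
    have s4 : Swappable (swapV j x) i := swappable_congr s3
      (by rw [s2.label_swapV, s1.label_swapV, hj, Equiv.swap_apply_right, k2])
      (by rw [s2.label_swapV, s1.label_swapV, hj, Equiv.swap_apply_left, k1])
    have s5 : Swappable (swapV j (swapV i x)) i := swappable_congr s2
      (by rw [s3.label_swapV, s1.label_swapV, hj, k2, Equiv.swap_apply_left])
      (by rw [s3.label_swapV, s1.label_swapV, hj, Equiv.swap_apply_left, k1])
    have s6 : Swappable (swapV i (swapV j x)) j := swappable_congr s1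
      (by rw [s4.label_swapV, s2.label_swapV, hj, Equiv.swap_apply_right, k2])
      (by rw [s4.label_swapV, s2.label_swapV, hj, k1, Equiv.swap_apply_right])
    have hc := swap_braid n1 n2 n3
    congr 2
    refine vertex_ext (fun k => ?_) (fun k => ?_)
    · rw [s5.swapV_snd, s3.swapV_snd, s1.swapV_snd, s6.swapV_snd, s4.swapV_snd, s2.swapV_snd, hj,
        hc]
    · rw [s5.cellAt_swapV, s3.cellAt_swapV, s1.cellAt_swapV, s6.cellAt_swapV, s4.cellAt_swapV,
        s2.cellAt_swapV, hj, hc]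
  have e0 := h.quadratic_braid hab hac hbc
  have e1 := h.diagCoeff_braid hab.ne hac hbc.ne
  have e2 := h.diagCoeff_braid' hab.ne hac hbc.ne
  generalize label x i.castSucc = a at *
  generalize label x i.succ = b at *
  generalize label x j.succ = c at *
  have step1 : wT s q j (wT s q i (bas K x)) =
      (diagCoeff s q a b * diagCoeff s q b c) • bas K x +
      (diagCoeff s q a b * swapCoeff s q b c) • bas K (swapV j x) +
      (swapCoeff s q a b * diagCoeff s q a c) • bas K (swapV i x) +
      (swapCoeff s q a b * swapCoeff s q a c) • bas K (swapV j (swapV i x)) := by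
    rw [h0i, map_add, map_smul, map_smul, h0j]
    linear_combination (norm := module) hij
  have step2 : wT s q i (wT s q j (bas K x)) =
      (diagCoeff s q b c * diagCoeff s q a b) • bas K x +
      (diagCoeff s q b c * swapCoeff s q a b) • bas K (swapV i x) +
      (swapCoeff s q b c * diagCoeff s q a c) • bas K (swapV j x) +
      (swapCoeff s q b c * swapCoeff s q a c) • bas K (swapV i (swapV j x)) := by
    rw [h0j, map_add, map_smul, map_smul, h0i]
    linear_combination (norm := module) hji
  simp only [Module.End.mul_apply]
  rw [step1, step2]
  simp only [map_add, map_smul]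
  rw [h0i, h0j]
  linear_combination (norm := module) diagCoeff s q a b • hji +
    diagCoeff s q a c • hii + hiji - diagCoeff s q b c • hij - diagCoeff s q a c • hjj - hjij +
    (diagCoeff s q a c * swapCoeff s q b a) • hi2 -
    (diagCoeff s q a c * swapCoeff s q c b) • hj2 + hlong + e0 • bas K x +
    (swapCoeff s q a b * e1) • bas K (swapV i x) - (swapCoeff s q b c * e2) • bas K (swapV j x)

theorem wT_mul_wPhi (i j : Fin n) (hij : (j : ℕ) = i + 1) :
    wT (lam := lam) s q i * wPhi = wPhi * wT s q j := by
  refine W_hom_ext fun x => ?_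
  have hj : i.succ = j.castSucc := Fin.ext hij.symm
  have h1 : label (affineV x) i.castSucc = label x j.castSucc := by
    rw [label_affineV_castSucc, hj]
  have h2 : label (affineV x) i.succ = label x j.succ := by
    rw [hj, label_affineV_castSucc]
  simp only [Module.End.mul_apply, wPhi_bas, wT_bas, map_add, map_smul, h1, h2]
  by_cases h : Swappable x j
  · rw [swapV_affineV hij h]
  · rw [swapCoeff_eq_zero h, zero_smul, zero_smul]

theorem IsGeneric.wT_mul_wPhi_wPhi (h : IsGeneric s q) (i j : Fin n) (hi : (i : ℕ) + 1 = n)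
    (hj : (j : ℕ) = 0) :
    wT (lam := lam) s q i * (wPhi * wPhi) = wPhi * wPhi * wT s q j := by
  refine W_hom_ext fun x => ?_
  have hil : i.succ = Fin.last n := Fin.ext hi
  have hj0 : j.castSucc = 0 := Fin.ext hj
  have h1 : label (affineV (affineV x)) i.castSucc = label x j.castSucc + (1, 0) := by
    rw [label_affineV_castSucc, hil, label_affineV_last, hj0]
  have h2 : label (affineV (affineV x)) i.succ = label x j.succ + (1, 0) := by
    rw [hil, label_affineV_last, ← hj0, label_affineV_castSucc]
  simp only [Module.End.mul_apply, wPhi_bas, wT_bas, map_add, map_smul, h1, h2,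
    h.diagCoeff_add, h.swapCoeff_add]
  by_cases hx : Swappable x j
  · rw [swapV_affineV_affineV hil hj0 hx]
    refine swappable_congr (x := affineV (affineV x)) (i := i) ?_ rfl rfl
    unfold Swappable at hx ⊢
    rw [h1, h2]
    simpa only [lSucc_add] using hx
  · rw [swapCoeff_eq_zero hx, zero_smul, zero_smul]

end Model

/-! ### Polynomials acting on the model -/

/-- Pairwise commuting elements of an algebra are the values of the variables under an algebra
homomorphism from a polynomial ring. -/
theorem exists_algHom_of_commute {K A σ : Type*} [Field K] [Ring A] [Algebra K A] (a : σ → A)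
    (ha : ∀ i j, Commute (a i) (a j)) :
    ∃ f : MvPolynomial σ K →ₐ[K] A, ∀ i, f (MvPolynomial.X i) = a i := by
  have hcomm : ∀ x ∈ Set.range a, ∀ y ∈ Set.range a, x * y = y * x := by
    rintro _ ⟨i, rfl⟩ _ ⟨j, rfl⟩
    exact ha i j
  have hS := Algebra.isMulCommutative_adjoin K hcomm
  let _ : CommRing (Algebra.adjoin K (Set.range a)) :=
    { (Algebra.adjoin K (Set.range a)).toRing with mul_comm := hS.is_comm.comm }
  refine ⟨(Algebra.adjoin K (Set.range a)).val.comp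
    (MvPolynomial.aeval fun i => ⟨a i, Algebra.subset_adjoin ⟨i, rfl⟩⟩), fun i => ?_⟩
  rw [AlgHom.comp_apply, MvPolynomial.aeval_X]
  rfl

section

variable {K : Type*} [Field K] {n : ℕ} {lam : YoungDiagram} {s q : K}

/-- The inverse of `T_i` on the model. -/
def wTinv (s q : K) (i : Fin n) : Module.End K (W K n lam) :=
  s⁻¹ • (wT s q i + (1 - s) • 1)

theorem IsGeneric.wT_mul_wTinv (h : IsGeneric s q) (i : Fin n) :
    wT (lam := lam) s q i * wTinv s q i = 1 := by
  unfold wTinv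
  rw [mul_smul_comm, mul_add, h.wT_quadratic, mul_smul_comm, mul_one, inv_smul_eq_iff₀ h.s_ne_zero]
  module

theorem IsGeneric.wTinv_mul_wT (h : IsGeneric s q) (i : Fin n) :
    wTinv (lam := lam) s q i * wT s q i = 1 := by
  unfold wTinv
  rw [smul_mul_assoc, add_mul, h.wT_quadratic, smul_mul_assoc, one_mul,
    inv_smul_eq_iff₀ h.s_ne_zero]
  module

/-- The Hecke operators of the model as units, indexed by natural numbers and equal to `1` out of
range. -/
def wTUnit (lam : YoungDiagram) (n : ℕ) (h : IsGeneric s q) (k : ℕ) :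
    (Module.End K (W K n lam))ˣ :=
  if hk : k < n then ⟨wT s q ⟨k, hk⟩, wTinv s q ⟨k, hk⟩, h.wT_mul_wTinv _, h.wTinv_mul_wT _⟩ else 1

theorem wTUnit_val (h : IsGeneric s q) (i : Fin n) : (wTUnit lam n h i).1 = wT s q i := by
  unfold wTUnit
  rw [dif_pos i.2]

theorem wTUnit_inv (h : IsGeneric s q) (i : Fin n) : ((wTUnit lam n h i)⁻¹).1 = wTinv s q i := by
  unfold wTUnit
  rw [dif_pos i.2]
  rfl

theorem isAffineBraid_wT (lam : YoungDiagram) (n : ℕ) (h : IsGeneric s q) :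
    IsAffineBraid n (fun k => (wTUnit lam n h k).1) wPhi where
  braid i hi := by
    have := h.wT_braid (lam := lam) ⟨i, by omega⟩ ⟨i + 1, hi⟩ rfl
    rwa [← wTUnit_val h, ← wTUnit_val h] at this
  comm i j hij hj := by
    have := IsGeneric.wT_comm (lam := lam) (s := s) (q := q) ⟨i, by omega⟩ ⟨j, hj⟩ hij
    rwa [← wTUnit_val h, ← wTUnit_val h] at this
  shift i hi := by
    have := wT_mul_wPhi (lam := lam) (s := s) (q := q) ⟨i, by omega⟩ ⟨i + 1, hi⟩ rfl
    rwa [← wTUnit_val h, ← wTUnit_val h] at this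
  wrap m hm := by
    have := h.wT_mul_wPhi_wPhi (lam := lam) (n := n) ⟨m, by omega⟩ ⟨0, by omega⟩ hm.symm rfl
    rwa [← wTUnit_val h, ← wTUnit_val h] at this

/-- The operators on the model by which the variables act:
`X_N = Φ T_1 ⋯ T_{N-1}` (composition of maps) and `X_i = s T_i⁻¹ X_{i+1} T_i⁻¹`. -/
def wX (lam : YoungDiagram) (n : ℕ) (h : IsGeneric s q) (k : Fin (n + 1)) :
    Module.End K (W K n lam) :=
  s ^ (n - (k : ℕ)) • conjSeq (fun i => ((wTUnit lam n h (n - 1 - i))⁻¹).1)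
    (wPhi * stairProd (fun i => (wTUnit lam n h i).1) n) (n - k)

theorem commute_wX (h : IsGeneric s q) (i j : Fin (n + 1)) :
    Commute (wX lam n h i) (wX lam n h j) :=
  (((isAffineBraid_wT lam n h).commute_conjSeq (i := n - i) (j := n - j)
    (by omega) (by omega)).smul_left _).smul_right _

theorem wX_last (h : IsGeneric s q) :
    wX lam n h (Fin.last n) = wPhi * stairProd (fun i => (wTUnit lam n h i).1) n := by
  unfold wX
  rw [Fin.val_last, Nat.sub_self, pow_zero, one_smul]
  rfl

theorem wX_castSucc (h : IsGeneric s q) (i : Fin n) :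
    wX lam n h i.castSucc = s • (wTinv s q i * wX lam n h i.succ * wTinv s q i) := by
  unfold wX
  have e : n - (i.castSucc : ℕ) = n - (i.succ : ℕ) + 1 := by
    simp only [Fin.val_castSucc, Fin.val_succ]; omega
  have e' : n - 1 - (n - (i.succ : ℕ)) = i := by
    simp only [Fin.val_succ]; omega
  rw [e, conjSeq, e', wTUnit_inv, pow_succ', mul_smul, mul_smul_comm, smul_mul_assoc]

theorem wT_mul_wX_castSucc (h : IsGeneric s q) (i : Fin n) :
    wT s q i * wX lam n h i.castSucc =
      (1 - s) • wX lam n h i.succ + wX lam n h i.succ * wT s q i := by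
  rw [wX_castSucc, mul_smul_comm, mul_assoc, ← mul_assoc, h.wT_mul_wTinv, one_mul, wTinv,
    mul_smul_comm, smul_inv_smul₀ h.s_ne_zero, mul_add, mul_smul_comm, mul_one, add_comm]

theorem wT_mul_wX_succ (h : IsGeneric s q) (i : Fin n) :
    wT s q i * wX lam n h i.succ =
      -((1 - s) • wX lam n h i.succ) + wX lam n h i.castSucc * wT s q i := by
  rw [wX_castSucc, smul_mul_assoc, mul_assoc, h.wTinv_mul_wT, mul_one, wTinv,
    smul_mul_assoc, smul_inv_smul₀ h.s_ne_zero, add_mul, smul_mul_assoc, one_mul]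
  abel

theorem wT_mul_wX_of_ne (h : IsGeneric s q) {i : Fin n} {k : Fin (n + 1)} (h1 : k ≠ i.castSucc)
    (h2 : k ≠ i.succ) : wT s q i * wX lam n h k = wX lam n h k * wT s q i := by
  have hb := isAffineBraid_wT lam n h
  have hc := commute_conjSeq_braid (n := n) hb.toIsBraid.inv.reverse
    (Z := wPhi * stairProd (fun i => (wTUnit lam n h i).1) n)
    (fun j h1 h2 => (hb.commute_raise (j := n - 1 - j) (by omega)).units_inv_right)
    (n - k) (by omega) (n - 1 - i) (by omega)
    (by simp only [ne_eq, Fin.ext_iff, Fin.val_castSucc, Fin.val_succ] at *; omega)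
    (by simp only [ne_eq, Fin.ext_iff, Fin.val_castSucc, Fin.val_succ] at *; omega)
  rw [show n - 1 - (n - 1 - (i : ℕ)) = i by omega] at hc
  have := (Commute.units_inv_right_iff.1 hc).symm.smul_right (s ^ (n - (k : ℕ)))
  rw [wTUnit_val] at this
  exact this

/-- The action of polynomials on the model. -/
def wEval (lam : YoungDiagram) (n : ℕ) (h : IsGeneric s q) :
    Poly K n →ₐ[K] Module.End K (W K n lam) :=
  (exists_algHom_of_commute (wX lam n h) (commute_wX h)).choose

theorem wEval_X (h : IsGeneric s q) (k : Fin (n + 1)) :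
    wEval lam n h (MvPolynomial.X k) = wX lam n h k :=
  (exists_algHom_of_commute (wX lam n h) (commute_wX h)).choose_spec k

/-! ### Divided differences -/

theorem polyS_mul (i : Fin n) (p r : Poly K n) : polyS i (p * r) = polyS i p * polyS i r := by
  simp [polyS]

theorem polyS_X (i : Fin n) (k : Fin (n + 1)) :
    polyS i (MvPolynomial.X k : Poly K n) =
      MvPolynomial.X (Equiv.swap i.castSucc i.succ k) := by
  simp [polyS]

theorem polyDelta_apply (i : Fin n) (p : Poly K n) :
    polyDelta s i p = (1 - s) • (MvPolynomial.X i.succ * divDiff i p) := by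
  simp [polyDelta]

theorem polyDelta_mul (i : Fin n) (p r : Poly K n) :
    polyDelta s i (p * r) = polyDelta s i p * r + polyS i p * polyDelta s i r := by
  have hd : divDiff i (p * r) = divDiff i p * r + polyS i p * divDiff i r := by
    apply mul_left_cancel₀ (X_sub_X_ne_zero (K := K) i)
    have h1 := divDiff_spec i p
    have h2 := divDiff_spec i r
    rw [divDiff_spec, polyS_mul]
    linear_combination -r * h1 - polyS i p * h2
  simp only [polyDelta_apply, hd, MvPolynomial.smul_eq_C_mul]
  ring

theorem polyDelta_C (i : Fin n) (c : K) : polyDelta s i (MvPolynomial.C c : Poly K n) = 0 := by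
  have hd : divDiff i (MvPolynomial.C c : Poly K n) = 0 := by
    apply mul_left_cancel₀ (X_sub_X_ne_zero (K := K) i)
    rw [divDiff_spec, mul_zero]
    simp [polyS]
  rw [polyDelta_apply, hd, mul_zero, smul_zero]

theorem polyDelta_X_castSucc (i : Fin n) :
    polyDelta s i (MvPolynomial.X i.castSucc : Poly K n) =
      (1 - s) • MvPolynomial.X i.succ := by
  have hd : divDiff i (MvPolynomial.X i.castSucc : Poly K n) = 1 := by
    apply mul_left_cancel₀ (X_sub_X_ne_zero (K := K) i)
    rw [divDiff_spec, polyS_X, Equiv.swap_apply_left, mul_one]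
  rw [polyDelta_apply, hd, mul_one]

theorem polyDelta_X_succ (i : Fin n) :
    polyDelta s i (MvPolynomial.X i.succ : Poly K n) =
      -((1 - s) • MvPolynomial.X i.succ) := by
  have hd : divDiff i (MvPolynomial.X i.succ : Poly K n) = -1 := by
    apply mul_left_cancel₀ (X_sub_X_ne_zero (K := K) i)
    rw [divDiff_spec, polyS_X, Equiv.swap_apply_right]
    ring
  rw [polyDelta_apply, hd, mul_neg, mul_one, smul_neg]

theorem polyDelta_X_of_ne {i : Fin n} {k : Fin (n + 1)} (h1 : k ≠ i.castSucc) (h2 : k ≠ i.succ) :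
    polyDelta s i (MvPolynomial.X k : Poly K n) = 0 := by
  have hd : divDiff i (MvPolynomial.X k : Poly K n) = 0 := by
    apply mul_left_cancel₀ (X_sub_X_ne_zero (K := K) i)
    rw [divDiff_spec, polyS_X, Equiv.swap_apply_of_ne_of_ne h1 h2, sub_self, mul_zero]
  rw [polyDelta_apply, hd, mul_zero, smul_zero]

theorem wT_mul_wX (h : IsGeneric s q) (i : Fin n) (k : Fin (n + 1)) :
    wT s q i * wX lam n h k = wEval lam n h (polyDelta s i (MvPolynomial.X k)) +
      wEval lam n h (polyS i (MvPolynomial.X k)) * wT s q i := by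
  rw [polyS_X, wEval_X]
  by_cases h1 : k = i.castSucc
  · subst h1
    rw [polyDelta_X_castSucc, Equiv.swap_apply_left, map_smul, wEval_X, wT_mul_wX_castSucc]
  by_cases h2 : k = i.succ
  · subst h2
    rw [polyDelta_X_succ, Equiv.swap_apply_right, map_neg, map_smul, wEval_X, wT_mul_wX_succ]
  · rw [polyDelta_X_of_ne h1 h2, Equiv.swap_apply_of_ne_of_ne h1 h2, map_zero, zero_add,
      wT_mul_wX_of_ne h h1 h2]

/-- The Bernstein relation: moving `T_i` past a polynomial. -/
theorem wT_mul_wEval (h : IsGeneric s q) (i : Fin n) (p : Poly K n) :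
    wT s q i * wEval lam n h p = wEval lam n h (polyDelta s i p) +
      wEval lam n h (polyS i p) * wT s q i := by
  induction p using MvPolynomial.induction_on with
  | C a =>
    rw [polyDelta_C, map_zero, zero_add]
    have : polyS i (MvPolynomial.C a : Poly K n) = MvPolynomial.C a := by simp [polyS]
    rw [this, ← MvPolynomial.algebraMap_eq, AlgHom.commutes]
    exact (Algebra.commutes a _).symm
  | add p r hp hr =>
    rw [map_add, mul_add, hp, hr, map_add, map_add, map_add, map_add, add_mul]
    abel
  | mul_X p k hp =>
    rw [map_mul, ← mul_assoc, hp, add_mul, mul_assoc, wEval_X, wT_mul_wX, polyDelta_mul,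
      polyS_mul, map_add, map_mul, map_mul, map_mul, wEval_X, mul_add]
    simp only [mul_assoc, add_assoc]

/-! ### The intertwiner from vector valued polynomials to the model -/

/-- The inclusion of `V_λ` into the model as the span of the vertices `(𝕋, 0)`. -/
def wIncl : V K n lam →ₗ[K] W K n lam := Finsupp.lmapDomain K K fun t => (t, 0)

theorem wIncl_single (t : RST n lam) (c : K) :
    wIncl (Finsupp.single t c) = c • bas K ((t, 0) : Vertex n lam) := by
  simp [wIncl]

theorem label_zero (t : RST n lam) (k : Fin (n + 1)) :
    label ((t, 0) : Vertex n lam) k = (0, t.ct k) := by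
  unfold label
  rw [rank_zero]
  rfl

theorem swapV_zero (t : RST n lam) (i : Fin n) (hr : t.row i.castSucc ≠ t.row i.succ)
    (hc : t.col i.castSucc ≠ t.col i.succ) :
    swapV i ((t, 0) : Vertex n lam) = (t.swap i hr hc, 0) := by
  symm
  refine IsSwap.eq_swapV (Or.inr ⟨rfl, rfl, ?_⟩)
  rw [rank_zero, rank_zero]
  rfl

theorem IsGeneric.wIncl_tabT (h : IsGeneric s q) (i : Fin n) (u : V K n lam) :
    wIncl (tabT s i u) = wT s q i (wIncl u) := by
  suffices hs : wIncl ∘ₗ tabT s i = wT s q i ∘ₗ (wIncl : V K n lam →ₗ[K] W K n lam) from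
    LinearMap.congr_fun hs u
  refine Finsupp.lhom_ext' fun t => LinearMap.ext_ring ?_
  simp only [LinearMap.comp_apply, Finsupp.lsingle_apply]
  rw [wIncl_single, one_smul, wT_bas, label_zero, label_zero]
  have hz : ∀ m : ℤ, zeta s q (0, m) = s ^ m := fun m => by simp [zeta]
  have hs := h.s_ne_zero
  have hs1 : s ≠ 1 := fun e => by
    have := h.eq_of_eq 0 0 1 0 (by simp [e])
    omega
  have h1s : (1 : K) - s ≠ 0 := fun e => hs1 (sub_eq_zero.1 e).symm
  have ht : tabT s i (Finsupp.single t 1) = tabTBasis s i t := by simp [tabT]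
  have hcons := t.consecutive (a := i.castSucc) (b := i.succ) rfl
  rw [ht]
  unfold tabTBasis
  by_cases hr : t.row i.castSucc = t.row i.succ
  · have hct : t.ct i.succ - t.ct i.castSucc = -1 := by unfold RST.ct; omega
    rw [dif_pos hr, wIncl_single, swapCoeff_eq_zero (by unfold LSucc; dsimp only; omega), zero_smul,
      add_zero]
    congr 1
    unfold diagCoeff
    rw [hz, hz, ← zpow_sub₀ hs, hct, zpow_neg_one,
      show 1 - s⁻¹ = -((1 - s) * s⁻¹) by field_simp; ring]
    field_simp
  by_cases hc : t.col i.castSucc = t.col i.succ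
  · have hct : t.ct i.succ - t.ct i.castSucc = 1 := by unfold RST.ct; omega
    rw [dif_neg hr, dif_pos hc, wIncl_single,
      swapCoeff_eq_zero (by unfold LSucc; dsimp only; omega), zero_smul, add_zero]
    congr 1
    unfold diagCoeff
    rw [hz, hz, ← zpow_sub₀ hs, hct, zpow_one, div_self h1s]
  · rw [dif_neg hr, dif_neg hc, swapV_zero t i hr hc]
    dsimp only
    unfold diagCoeff swapCoeff
    rw [hz, hz, ← zpow_sub₀ hs]
    by_cases hlt : t.row i.castSucc < t.row i.succ
    · rw [if_pos hlt, if_pos (by unfold LSucc RST.ct; dsimp only; omega), map_sub, wIncl_single,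
        wIncl_single]
      module
    · rw [if_neg hlt, if_neg (by unfold LSucc RST.ct; dsimp only; omega),
        if_pos (by unfold LSucc RST.ct; dsimp only; omega), map_add, wIncl_single,
        wIncl_single, zpow_add_one₀ hs, zpow_sub_one₀ hs, ← neg_sub (1 : K) s, neg_div]

/-- The intertwiner `p ⊗ u ↦ p(X) u` from vector valued polynomials to the model. -/
def toModel (lam : YoungDiagram) (n : ℕ) (h : IsGeneric s q) : M K n lam →ₗ[K] W K n lam :=
  TensorProduct.lift (LinearMap.lcomp K (W K n lam) wIncl ∘ₗ (wEval lam n h).toLinearMap)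

theorem toModel_tmul (h : IsGeneric s q) (p : Poly K n) (u : V K n lam) :
    toModel lam n h (p ⊗ₜ u) = wEval lam n h p (wIncl u) := by
  simp [toModel]

theorem toModel_bT (h : IsGeneric s q) (i : Fin n) (f : M K n lam) :
    toModel lam n h (bT s i f) = wT s q i (toModel lam n h f) := by
  induction f using TensorProduct.induction_on with
  | zero => simp
  | add f g hf hg => rw [map_add, map_add, map_add, map_add, hf, hg]
  | tmul p u =>
    have := LinearMap.congr_fun (wT_mul_wEval (lam := lam) h i p) (wIncl u)
    simp only [Module.End.mul_apply, LinearMap.add_apply] at this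
    rw [toModel_tmul, this, bT, LinearMap.add_apply, TensorProduct.map_tmul,
      TensorProduct.map_tmul, map_add, toModel_tmul, toModel_tmul, h.wIncl_tabT]
    rfl

theorem toModel_bTinv (h : IsGeneric s q) (i : Fin n) (f : M K n lam) :
    toModel lam n h (bTinv s i f) = wTinv s q i (toModel lam n h f) := by
  simp only [bTinv, wTinv, LinearMap.smul_apply, LinearMap.add_apply, map_smul, map_add,
    toModel_bT, LinearMap.id_apply, Module.End.one_apply]

theorem toModel_foldl (h : IsGeneric s q) (f : M K n lam) : ∀ k ≤ n,
    stairProd (fun i => (wTUnit lam n h i).1) k (toModel lam n h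
      (((List.range k).map fun j => if hj : j < n then bTinv s ⟨j, hj⟩ else LinearMap.id).foldl
        (fun f g => g ∘ₗ f) LinearMap.id f)) = toModel lam n h f := by
  intro k
  induction k with
  | zero => intro _; rfl
  | succ k ih =>
    intro hk
    rw [List.range_succ, List.map_append, List.foldl_append, List.map_singleton,
      List.foldl_cons, List.foldl_nil, dif_pos (show k < n by omega), LinearMap.comp_apply,
      toModel_bTinv, stairProd, Module.End.mul_apply, ← Module.End.mul_apply _ (wTinv _ _ _),
      wTUnit_val h ⟨k, hk⟩, h.wT_mul_wTinv, Module.End.one_apply, ih (by omega)]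

theorem toModel_bPhi (h : IsGeneric s q) (f : M K n lam) :
    toModel lam n h (bPhi s f) = wPhi (toModel lam n h f) := by
  have hl : (List.ofFn fun i : Fin n => bTinv (lam := lam) s i) =
      (List.range n).map fun j => if hj : j < n then bTinv s ⟨j, hj⟩ else LinearMap.id := by
    apply List.ext_getElem
    · simp
    · intro j h1 h2
      simp at h1
      simp [h1]
  have hX : ∀ g : M K n lam,
      toModel lam n h (TensorProduct.map (LinearMap.mulLeft K (MvPolynomial.X (Fin.last n)))
        LinearMap.id g) = wX lam n h (Fin.last n) (toModel lam n h g) := by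
    intro g
    induction g using TensorProduct.induction_on with
    | zero => simp
    | add f g hf hg => rw [map_add, map_add, hf, hg, map_add, map_add]
    | tmul p u =>
      rw [TensorProduct.map_tmul, toModel_tmul, toModel_tmul, LinearMap.mulLeft_apply, map_mul,
        wEval_X]
      rfl
  unfold bPhi
  rw [LinearMap.comp_apply, hX, wX_last, Module.End.mul_apply, hl, toModel_foldl h f n le_rfl]

/-- The intertwiner maps the polynomial of every path to the basis vector of its endpoint. -/
theorem IsPathPoly.toModel_eq (h : IsGeneric s q) {x : Vertex n lam} {p : M K n lam}
    (hp : IsPathPoly s q x p) : toModel lam n h p = bas K x := by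
  induction hp with
  | root t ht =>
    rw [toModel_tmul, map_one, Module.End.one_apply, wIncl_single, one_smul]
  | arrow i x y p hp ha ih =>
    rw [map_add, map_smul, toModel_bT, ih, wT_bas, ha.2.eq_swapV]
    have h1 : swapCoeff s q (label x i.castSucc) (label x i.succ) = 1 := if_pos ha.1
    rw [h1, diagCoeff, spec_eq_zeta, spec_eq_zeta]
    module
  | affine x p hp ih =>
    rw [toModel_bPhi, ih, wPhi_bas]
    rfl

end

/-! ### Inversions -/

/-- Exchanging two neighbours of a sequence `l` changes a product over all pairs `i < j` only in
the factor of the exchanged pair. -/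
@[to_additive /-- Exchanging two neighbours of a sequence `l` changes a sum over all pairs `i < j`
only in the summand of the exchanged pair. -/]
theorem prod_pairs_swap {M L : Type*} [CommMonoid M] {n : ℕ} (l : Fin (n + 1) → L) (g : L → L → M)
    (i : Fin n) :
    (∏ p : Fin (n + 1) × Fin (n + 1) with p.1 < p.2,
      g (l (Equiv.swap i.castSucc i.succ p.1)) (l (Equiv.swap i.castSucc i.succ p.2))) *
        g (l i.castSucc) (l i.succ) =
    (∏ p : Fin (n + 1) × Fin (n + 1) with p.1 < p.2, g (l p.1) (l p.2)) *
        g (l i.succ) (l i.castSucc) := by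
  have hmem : (i.castSucc, i.succ) ∈
      (Finset.univ.filter fun p : Fin (n + 1) × Fin (n + 1) => p.1 < p.2) := by
    rw [Finset.mem_filter]
    exact ⟨Finset.mem_univ _, Fin.castSucc_lt_succ⟩
  rw [← Finset.mul_prod_erase _ _ hmem, ← Finset.mul_prod_erase _ (fun p => g (l p.1) (l p.2)) hmem]
  dsimp only
  rw [Equiv.swap_apply_left, Equiv.swap_apply_right]
  have hlt : ∀ a b : Fin (n + 1), a < b → (a, b) ≠ (i.castSucc, i.succ) →
      Equiv.swap i.castSucc i.succ a < Equiv.swap i.castSucc i.succ b ∧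
      (Equiv.swap i.castSucc i.succ a, Equiv.swap i.castSucc i.succ b) ≠
        (i.castSucc, i.succ) := by
    intro a b hab hne
    have h1 : (i.castSucc : Fin (n + 1)).val = i.val := rfl
    have h2 : (i.succ : Fin (n + 1)).val = i.val + 1 := rfl
    simp only [ne_eq, Prod.mk.injEq] at *
    rw [Equiv.swap_apply_def, Equiv.swap_apply_def]
    split_ifs <;> simp only [Fin.ext_iff, Fin.lt_def] at * <;> omega
  have hprod : (∏ p ∈ (Finset.univ.filter fun p : Fin (n + 1) × Fin (n + 1) => p.1 < p.2).erase
        (i.castSucc, i.succ),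
      g (l (Equiv.swap i.castSucc i.succ p.1)) (l (Equiv.swap i.castSucc i.succ p.2))) =
      ∏ p ∈ (Finset.univ.filter fun p : Fin (n + 1) × Fin (n + 1) => p.1 < p.2).erase
        (i.castSucc, i.succ), g (l p.1) (l p.2) := by
    refine Finset.prod_nbij'
      (fun p => (Equiv.swap i.castSucc i.succ p.1, Equiv.swap i.castSucc i.succ p.2))
      (fun p => (Equiv.swap i.castSucc i.succ p.1, Equiv.swap i.castSucc i.succ p.2))
      ?_ ?_ ?_ ?_ ?_
    · intro p hp
      rw [Finset.mem_erase, Finset.mem_filter] at hp ⊢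
      have := hlt p.1 p.2 hp.2.2 hp.1
      exact ⟨this.2, Finset.mem_univ _, this.1⟩
    · intro p hp
      rw [Finset.mem_erase, Finset.mem_filter] at hp ⊢
      have := hlt p.1 p.2 hp.2.2 hp.1
      exact ⟨this.2, Finset.mem_univ _, this.1⟩
    · intro p _
      simp
    · intro p _
      simp
    · intro p _
      rfl
  rw [hprod, mul_right_comm, mul_right_comm (g (l i.castSucc) (l i.succ)),
    mul_comm (g (l i.succ) (l i.castSucc))]

section

variable {n : ℕ} {lam : YoungDiagram}

open Classical in
/-- The number of pairs of positions `i < j` with `ζ[i] ≻ ζ[j]`. -/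
def invCount (x : Vertex n lam) : ℕ :=
  ∑ p : Fin (n + 1) × Fin (n + 1) with p.1 < p.2,
    if LSucc (label x p.1) (label x p.2) then 1 else 0

theorem Arrow.invCount_eq {x y : Vertex n lam} {i : Fin n} (h : Arrow i x y) :
    invCount y = invCount x + 1 := by
  classical
  have := sum_pairs_swap (label x) (fun a b => if LSucc a b then 1 else 0) i
  rw [if_neg (LSucc.asymm ((succ_iff _ _ _).1 h.1)), if_pos ((succ_iff _ _ _).1 h.1),
    add_zero] at this
  unfold invCount
  rw [h.2.eq_swapV]
  simp only [h.swappable.label_swapV]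
  convert this

/-- No arrow enters `x`. -/
def IsTerminal (x : Vertex n lam) : Prop :=
  ∀ i : Fin n, ¬ LSucc (label x i.castSucc) (label x i.succ)

theorem isTerminal_iff {x : Vertex n lam} :
    IsTerminal x ↔ ∀ (i : Fin n) (y : Vertex n lam), ¬ Arrow i y x := by
  refine ⟨fun h i y ha => h i ?_, fun h i hl => h i _ (arrow_swapV_self_of_lSucc hl)⟩
  rw [ha.2.eq_swapV, ha.swappable.label_swapV, ha.swappable.label_swapV, Equiv.swap_apply_left,
    Equiv.swap_apply_right]
  exact ha.1

/-- The order of cells in which the positions of a root are filled: by increasing value, then by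
decreasing column, then by decreasing row. -/
def rootKey (k : ℕ) (c : lam.cells) : ℕ ×ₗ (ℕᵒᵈ ×ₗ ℕᵒᵈ) :=
  toLex (k, toLex (OrderDual.toDual c.1.2, OrderDual.toDual c.1.1))

theorem rootKey_lt {k k' : ℕ} {c c' : lam.cells} : rootKey k c < rootKey k' c' ↔
    k < k' ∨ (k = k' ∧ (c'.1.2 < c.1.2 ∨ (c.1.2 = c'.1.2 ∧ c'.1.1 < c.1.1))) := by
  unfold rootKey
  simp only [Prod.Lex.toLex_lt_toLex, OrderDual.toDual_lt_toDual, OrderDual.toDual_inj]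

/-- Without incoming arrows, neighbouring positions are in the order of the root key: among equal
values of `v`, two consecutive entries of the tableau in the opposite order would lie north-west
and south-east of each other, and an arrow would exchange them. -/
theorem IsTerminal.strictMono {x : Vertex n lam} (h : IsTerminal x) :
    StrictMono fun i => rootKey (x.2 i) (cellAt x i) := by
  refine Fin.strictMono_iff_lt_succ.2 fun i => rootKey_lt.2 ?_
  have hi := h i
  rw [label_eq, label_eq] at hi
  unfold LSucc at hi
  dsimp only at hi
  by_cases hv : x.2 i.castSucc = x.2 i.succ
  · have := x.1.consecutive (rank_succ_of_eq hv)
    unfold RST.row RST.col at this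
    unfold cellAt at *
    omega
  · omega

/-! ### Existence of paths -/

/-- The degree `|v|` of the polynomial attached to `(𝕋, v)`. -/
def vdeg (x : Vertex n lam) : ℕ := ∑ i, x.2 i

theorem Swappable.vdeg_swapV {x : Vertex n lam} {i : Fin n} (h : Swappable x i) :
    vdeg (VVMac.swapV i x) = vdeg x := by
  unfold vdeg
  simp only [h.swapV_snd]
  exact Equiv.sum_comp (Equiv.swap i.castSucc i.succ) x.2

theorem vdeg_affineV (x : Vertex n lam) : vdeg (affineV x) = vdeg x + 1 := by
  unfold vdeg
  simp only [affineV_snd]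
  rw [Finset.sum_add_distrib, Equiv.sum_comp (finRotate (n + 1)) x.2]
  simp

theorem IsTerminal.isRootTableau {t : RST n lam} (h : IsTerminal ((t, 0) : Vertex n lam)) :
    IsRootTableau t := by
  intro a b hab
  have := rootKey_lt.1 (h.strictMono hab)
  unfold cellAt at this
  rw [rank_zero, rank_zero] at this
  unfold RST.row RST.col
  simp only [Pi.zero_apply] at this
  omega

theorem IsTerminal.monotone {x : Vertex n lam} (h : IsTerminal x) : Monotone x.2 := by
  refine Fin.monotone_iff_le_succ.2 fun i => ?_
  by_contra hc
  exact h i (Or.inl (not_le.1 hc))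

theorem IsTerminal.exists_affineV_eq {x : Vertex n lam} (h : IsTerminal x) (hx : x.2 ≠ 0) :
    ∃ y, affineV y = x := by
  have hpos : 0 < x.2 (Fin.last n) := by
    rw [pos_iff_ne_zero]
    intro h0
    exact hx (funext fun i => Nat.le_zero.1 (h0 ▸ h.monotone (Fin.le_last i)))
  refine ⟨(x.1, Fin.cons (x.2 (Fin.last n) - 1) fun i : Fin n => x.2 i.castSucc), ?_⟩
  refine Prod.ext rfl (funext fun i => ?_)
  show affine _ i = _
  induction i using Fin.lastCases with
  | last => exact (affine_last _).trans (Nat.sub_add_cancel hpos)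
  | cast i => exact affine_castSucc _ _

/-- Every vertex is the endpoint of a path: walking backwards, an arrow `s_i` lowers the number of
inversions, and a vertex without incoming arrow `s_i` is a root or the target of an affine
arrow. -/
theorem exists_isPathPoly {K : Type*} [Field K] (s q : K) (x : Vertex n lam) :
    ∃ p : M K n lam, IsPathPoly s q x p := by
  induction hd : vdeg x using Nat.strong_induction_on generalizing x with
  | _ d ihd =>
  induction hi : invCount x using Nat.strong_induction_on generalizing x with
  | _ m ihm =>
  by_cases ht : IsTerminal x
  · by_cases hx : x.2 = 0
    · obtain ⟨t, v⟩ := x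
      obtain rfl : v = 0 := hx
      exact ⟨_, IsPathPoly.root t ht.isRootTableau⟩
    · obtain ⟨y, rfl⟩ := ht.exists_affineV_eq hx
      obtain ⟨p, hp⟩ := ihd (vdeg y) (by rw [← hd, vdeg_affineV]; omega) y rfl
      exact ⟨_, IsPathPoly.affine y p hp⟩
  · unfold IsTerminal at ht
    push Not at ht
    obtain ⟨i, hl⟩ := ht
    have ha := arrow_swapV_self_of_lSucc hl
    have hs : Swappable x i := Or.inr hl
    obtain ⟨p, hp⟩ := ihm (invCount (swapV i x)) (by have := ha.invCount_eq; omega) (swapV i x)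
      (by rw [hs.vdeg_swapV, hd]) rfl
    exact ⟨_, IsPathPoly.arrow i _ x p hp ha⟩

theorem isPathPoly_macdonald {K : Type*} [Field K] (s q : K) (x : Vertex n lam) :
    IsPathPoly s q x (macdonald s q x) := by
  unfold macdonald
  rw [dif_pos (exists_isPathPoly s q x)]
  exact (exists_isPathPoly s q x).choose_spec

end

/-! ### Degrees -/

section

variable {K : Type*} [Field K] {n : ℕ} {lam : YoungDiagram} {s q : K}

theorem isHomogeneous_polyS {p : Poly K n} {d : ℕ} (i : Fin n) (hp : p.IsHomogeneous d) :
    (polyS i p).IsHomogeneous d := hp.rename_isHomogeneous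

theorem isHomogeneous_polyDelta_X (i : Fin n) (k : Fin (n + 1)) :
    (polyDelta s i (MvPolynomial.X k : Poly K n)).IsHomogeneous 1 := by
  by_cases h1 : k = i.castSucc
  · subst h1
    rw [polyDelta_X_castSucc, MvPolynomial.smul_eq_C_mul]
    exact (MvPolynomial.isHomogeneous_X K i.succ).C_mul _
  by_cases h2 : k = i.succ
  · subst h2
    rw [polyDelta_X_succ, MvPolynomial.smul_eq_C_mul]
    exact ((MvPolynomial.isHomogeneous_X K i.succ).C_mul _).neg
  · rw [polyDelta_X_of_ne h1 h2]
    exact MvPolynomial.isHomogeneous_zero _ _ _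

theorem isHomogeneous_polyDelta {p : Poly K n} {d : ℕ} (i : Fin n) (hp : p.IsHomogeneous d) :
    (polyDelta s i p).IsHomogeneous d := by
  have key : ∀ (m : Fin (n + 1) →₀ ℕ) (c : K),
      ∃ e, (MvPolynomial.monomial m c : Poly K n).IsHomogeneous e ∧
        (polyDelta s i (MvPolynomial.monomial m c)).IsHomogeneous e := by
    intro m c
    refine MvPolynomial.induction_on_monomial
      (motive := fun p => ∃ e, p.IsHomogeneous e ∧ (polyDelta s i p).IsHomogeneous e)
      (fun a => ⟨0, MvPolynomial.isHomogeneous_C _ _, ?_⟩) (fun p k hp => ?_) m c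
    · rw [polyDelta_C]
      exact MvPolynomial.isHomogeneous_zero _ _ _
    · obtain ⟨e, h1, h2⟩ := hp
      refine ⟨e + 1, h1.mul (MvPolynomial.isHomogeneous_X _ _), ?_⟩
      rw [polyDelta_mul]
      exact (h2.mul (MvPolynomial.isHomogeneous_X _ _)).add
        ((isHomogeneous_polyS i h1).mul (isHomogeneous_polyDelta_X i k))
  rw [p.as_sum, map_sum]
  refine MvPolynomial.IsHomogeneous.sum _ _ _ fun m hm => ?_
  have hc : MvPolynomial.coeff m p ≠ 0 := MvPolynomial.mem_support_iff.1 hm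
  obtain ⟨e, h1, h2⟩ := key m (MvPolynomial.coeff m p)
  have h3 : (MvPolynomial.monomial m (MvPolynomial.coeff m p)).IsHomogeneous d :=
    MvPolynomial.isHomogeneous_monomial _ (by rw [Finsupp.degree_eq_weight_one]; exact hp hc)
  rwa [h1.inj_right h3 (by simpa using hc)] at h2

/-- The vector valued polynomials which are homogeneous of degree `d`. -/
def homM (K : Type*) [Field K] (n : ℕ) (lam : YoungDiagram) (d : ℕ) : Submodule K (M K n lam) :=
  Submodule.span K {f | ∃ (p : Poly K n) (u : V K n lam), p.IsHomogeneous d ∧ f = p ⊗ₜ u}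

theorem tmul_mem_homM {p : Poly K n} {d : ℕ} (hp : p.IsHomogeneous d) (u : V K n lam) :
    p ⊗ₜ u ∈ homM K n lam d := Submodule.subset_span ⟨p, u, hp, rfl⟩

theorem bT_mem_homM {f : M K n lam} {d : ℕ} (i : Fin n) (hf : f ∈ homM K n lam d) :
    bT s i f ∈ homM K n lam d := by
  refine Submodule.span_induction (p := fun f _ => bT s i f ∈ homM K n lam d) ?_ ?_ ?_ ?_ hf
  · rintro _ ⟨p, u, hp, rfl⟩
    rw [bT, LinearMap.add_apply, TensorProduct.map_tmul, TensorProduct.map_tmul]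
    exact add_mem (tmul_mem_homM (isHomogeneous_polyDelta i hp) _)
      (tmul_mem_homM (isHomogeneous_polyS i hp) _)
  · rw [map_zero]; exact zero_mem _
  · intro f g _ _ hf hg
    rw [map_add]; exact add_mem hf hg
  · intro c f _ hf
    rw [map_smul]; exact Submodule.smul_mem _ _ hf

theorem bPhi_mem_homM {f : M K n lam} {d : ℕ} (hf : f ∈ homM K n lam d) :
    bPhi s f ∈ homM K n lam (d + 1) := by
  have hfold : ∀ (l : List (M K n lam →ₗ[K] M K n lam)) (g : M K n lam →ₗ[K] M K n lam),
      (∀ T ∈ l, ∀ f ∈ homM K n lam d, T f ∈ homM K n lam d) → g f ∈ homM K n lam d →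
      l.foldl (fun f g => g ∘ₗ f) g f ∈ homM K n lam d := by
    intro l
    induction l with
    | nil => exact fun g _ hg => hg
    | cons T l ih =>
      intro g hl hg
      exact ih _ (fun T' hT' => hl T' (List.mem_cons_of_mem _ hT'))
        (hl T List.mem_cons_self _ hg)
  have hX : ∀ g ∈ homM K n lam d,
      TensorProduct.map (LinearMap.mulLeft K (MvPolynomial.X (Fin.last n))) LinearMap.id g ∈
        homM K n lam (d + 1) := by
    intro g hg
    refine Submodule.span_induction (p := fun g _ =>
      TensorProduct.map (LinearMap.mulLeft K (MvPolynomial.X (Fin.last n))) LinearMap.id g ∈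
        homM K n lam (d + 1)) ?_ ?_ ?_ ?_ hg
    · rintro _ ⟨p, u, hp, rfl⟩
      rw [TensorProduct.map_tmul, LinearMap.mulLeft_apply, mul_comm]
      exact tmul_mem_homM (hp.mul (MvPolynomial.isHomogeneous_X _ _)) _
    · rw [map_zero]; exact zero_mem _
    · intro f g _ _ hf hg
      rw [map_add]; exact add_mem hf hg
    · intro c f _ hf
      rw [map_smul]; exact Submodule.smul_mem _ _ hf
  refine hX _ (hfold _ _ ?_ hf)
  intro T hT f hf
  obtain ⟨i, rfl⟩ := List.mem_ofFn.1 hT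
  exact Submodule.smul_mem _ _ (add_mem (bT_mem_homM i hf) (Submodule.smul_mem _ _ hf))

theorem IsPathPoly.mem_homM {x : Vertex n lam} {p : M K n lam} (hp : IsPathPoly s q x p) :
    p ∈ homM K n lam (vdeg x) := by
  induction hp with
  | root t ht =>
    have : vdeg ((t, 0) : Vertex n lam) = 0 := by simp [vdeg]
    rw [this]
    exact tmul_mem_homM (MvPolynomial.isHomogeneous_one _ _) _
  | arrow i x y p hp ha ih =>
    rw [ha.2.eq_swapV, ha.swappable.vdeg_swapV]
    exact add_mem (bT_mem_homM i ih) (Submodule.smul_mem _ _ ih)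
  | affine x p hp ih =>
    have : vdeg ((x.1, VVMac.affine x.2) : Vertex n lam) = vdeg x + 1 := vdeg_affineV x
    rw [this]
    exact bPhi_mem_homM ih

/-! ### The Macdonald polynomials form a basis -/

instance (n : ℕ) (lam : YoungDiagram) (d : ℕ) : Finite {x : Vertex n lam // vdeg x = d} := by
  have hfin : (((Set.univ : Set (RST n lam)) ×ˢ
      (Set.pi Set.univ fun _ : Fin (n + 1) => Set.Iic d)) : Set (Vertex n lam)).Finite :=
    Set.finite_univ.prod (Set.Finite.pi fun _ => Set.finite_Iic _)
  refine (hfin.subset fun x hx => ⟨Set.mem_univ _, fun i _ => ?_⟩ : Set.Finite {x | vdeg x = d})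
  rw [Set.mem_Iic, ← show vdeg x = d from hx]
  exact Finset.single_le_sum (f := x.2) (fun _ _ => Nat.zero_le _) (Finset.mem_univ i)

/-- The monomial vector valued polynomial `x^v ⊗ 𝕋`. -/
def monoM (K : Type*) [Field K] {n : ℕ} {lam : YoungDiagram} (x : Vertex n lam) : M K n lam :=
  MvPolynomial.monomial (Finsupp.equivFunOnFinite.symm x.2) 1 ⊗ₜ Finsupp.single x.1 1

theorem tmul_mem_of_monomials {S : Submodule K (M K n lam)} {p : Poly K n}
    (hS : ∀ (t : RST n lam) (m : Fin (n + 1) →₀ ℕ), MvPolynomial.coeff m p ≠ 0 →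
      monoM K (t, m) ∈ S) (u : V K n lam) :
    p ⊗ₜ u ∈ S := by
  induction u using Finsupp.induction_linear with
  | zero => rw [TensorProduct.tmul_zero]; exact zero_mem _
  | add u w hu hw => rw [TensorProduct.tmul_add]; exact add_mem hu hw
  | single t c =>
    rw [p.as_sum, TensorProduct.sum_tmul]
    refine sum_mem fun m hm => ?_
    have h1 := hS t m (MvPolynomial.mem_support_iff.1 hm)
    have h2 : (MvPolynomial.monomial m (MvPolynomial.coeff m p) : Poly K n) ⊗ₜ[K]
        (Finsupp.single t c : V K n lam) =
        (MvPolynomial.coeff m p * c) • monoM K ((t, m) : Vertex n lam) := by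
      have e1 : (MvPolynomial.monomial m (MvPolynomial.coeff m p) : Poly K n) =
          MvPolynomial.coeff m p • MvPolynomial.monomial m 1 := by
        rw [MvPolynomial.smul_monomial, smul_eq_mul, mul_one]
      have e2 : (Finsupp.single t c : V K n lam) = c • Finsupp.single t 1 := by simp
      rw [e1, e2, TensorProduct.smul_tmul_smul]
      simp [monoM]
    rw [h2]
    exact Submodule.smul_mem _ _ h1

theorem toModel_macdonald (h : IsGeneric s q) (x : Vertex n lam) :
    toModel lam n h (macdonald s q x) = bas K x := (isPathPoly_macdonald s q x).toModel_eq h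

/-- The Macdonald polynomials of degree `d` are linearly independent, as the intertwiner maps
them to basis vectors, and there are as many of them as monomials `x^v ⊗ 𝕋` of degree `d`. -/
theorem monoM_mem_span_macdonald (h : IsGeneric s q) (x : Vertex n lam) :
    monoM K x ∈ Submodule.span K (Set.range (macdonald (lam := lam) (n := n) s q)) := by
  have := Fintype.ofFinite {y : Vertex n lam // vdeg y = vdeg x}
  let P : {y : Vertex n lam // vdeg y = vdeg x} → M K n lam := fun y => macdonald s q y.1
  let Q : {y : Vertex n lam // vdeg y = vdeg x} → M K n lam := fun y => monoM K y.1
  have hP : LinearIndependent K P := by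
    refine LinearIndependent.of_comp (toModel lam n h) ?_
    have e : ⇑(toModel lam n h) ∘ P = (fun y => bas K y) ∘ Subtype.val :=
      funext fun y => toModel_macdonald h y.1
    rw [e]
    exact (Finsupp.linearIndependent_single_one K (Vertex n lam)).comp _ Subtype.val_injective
  have hle : Submodule.span K (Set.range P) ≤ Submodule.span K (Set.range Q) := by
    have h1 : homM K n lam (vdeg x) ≤ Submodule.span K (Set.range Q) := by
      refine Submodule.span_le.2 ?_
      rintro _ ⟨p, u, hp, rfl⟩
      refine tmul_mem_of_monomials (fun t m hm => ?_) u
      have hd : vdeg ((t, m) : Vertex n lam) = vdeg x := by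
        have e : m.degree = vdeg x := by
          rw [Finsupp.degree_eq_weight_one]
          exact hp hm
        rw [← e, Finsupp.degree_eq_sum]
        rfl
      exact Submodule.subset_span
        (Set.mem_range_self (⟨(t, m), hd⟩ : {y : Vertex n lam // vdeg y = vdeg x}))
    refine (Submodule.span_le.2 ?_).trans h1
    rintro _ ⟨y, rfl⟩
    exact y.2 ▸ (isPathPoly_macdonald s q y.1).mem_homM
  have hfin : FiniteDimensional K (Submodule.span K (Set.range Q)) :=
    FiniteDimensional.span_of_finite K (Set.finite_range Q)
  have heq := Submodule.eq_of_le_of_finrank_le hle (by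
    rw [finrank_span_eq_card hP]
    exact finrank_range_le_card Q)
  have hx : monoM K x ∈ Submodule.span K (Set.range Q) := 
    Submodule.subset_span (Set.mem_range_self (⟨x, rfl⟩ : {y : Vertex n lam // vdeg y = vdeg x}))
  rw [← heq] at hx
  refine Submodule.span_mono ?_ hx
  rintro _ ⟨y, rfl⟩
  exact ⟨y.1, rfl⟩

theorem span_macdonald (h : IsGeneric s q) :
    Submodule.span K (Set.range (macdonald (lam := lam) (n := n) s q)) = ⊤ := by
  refine eq_top_iff.2 fun f _ => ?_
  induction f using TensorProduct.induction_on with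
  | zero => exact zero_mem _
  | add f g hf hg => exact add_mem (hf trivial) (hg trivial)
  | tmul p u => exact tmul_mem_of_monomials (fun t m _ => monoM_mem_span_macdonald h _) u

theorem toModel_injective (h : IsGeneric s q) : Function.Injective (toModel lam n h) := by
  refine (injective_iff_map_eq_zero _).2 fun f hf => ?_
  have hmem : f ∈ Submodule.span K (Set.range (macdonald (lam := lam) (n := n) s q)) := by
    rw [span_macdonald h]; trivial
  obtain ⟨c, rfl⟩ := Finsupp.mem_span_range_iff_exists_finsupp.1 hmem
  have hc : c = 0 := by
    rw [map_finsuppSum] at hf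
    simp only [map_smul, toModel_macdonald h, Finsupp.smul_single, smul_eq_mul, mul_one] at hf
    rwa [Finsupp.sum_single] at hf
  rw [hc, Finsupp.sum_zero_index]

end

/-! ### Antisymmetric vectors of the model -/

section

variable {K : Type*} [Field K] {n : ℕ} {lam : YoungDiagram} {s q : K}

theorem wT_apply (i : Fin n) (f : W K n lam) (x : Vertex n lam) :
    wT s q i f x = diagCoeff s q (label x i.castSucc) (label x i.succ) * f x +
      swapCoeff s q (label x i.succ) (label x i.castSucc) * f (swapV i x) := by
  classical
  induction f using Finsupp.induction_linear with
  | zero => simp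
  | add f g hf hg => rw [map_add, Finsupp.add_apply, hf, hg, Finsupp.add_apply, Finsupp.add_apply]; ring
  | single y c =>
    have e : (Finsupp.single y c : W K n lam) = c • bas K y := by simp
    rw [e, map_smul, wT_bas]
    simp only [Finsupp.smul_apply, Finsupp.add_apply, Finsupp.single_apply, smul_eq_mul]
    have h1 : diagCoeff s q (label y i.castSucc) (label y i.succ) * (if y = x then 1 else 0) =
        diagCoeff s q (label x i.castSucc) (label x i.succ) * (if y = x then 1 else 0) := by
      by_cases h : y = x
      · rw [h]
      · rw [if_neg h, mul_zero, mul_zero]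
    have h2 : swapCoeff s q (label y i.castSucc) (label y i.succ) *
          (if swapV i y = x then 1 else 0) =
        swapCoeff s q (label x i.succ) (label x i.castSucc) *
          (if y = swapV i x then 1 else 0) := by
      by_cases hx : Swappable x i
      · by_cases hy : y = swapV i x
        · rw [if_pos hy, hy, hx.swapV_swapV, if_pos rfl, hx.label_swapV, hx.label_swapV,
            Equiv.swap_apply_left, Equiv.swap_apply_right]
        · rw [if_neg hy, mul_zero]
          by_cases hy' : Swappable y i
          · rw [if_neg, mul_zero]
            rintro rfl
            exact hy hy'.swapV_swapV.symm
          · rw [swapCoeff_eq_zero hy', zero_mul]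
      · rw [swapCoeff_eq_zero (fun h => hx (Or.symm h)), zero_mul]
        by_cases hy' : Swappable y i
        · rw [if_neg, mul_zero]
          rintro rfl
          exact hx hy'.swapV
        · rw [swapCoeff_eq_zero hy', zero_mul]
    rw [h1, h2]
    ring

/-- The factor by which the coefficient of an antisymmetric vector changes along an arrow `s_i`
leaving a vertex with `ζ[i]`, `ζ[i+1]` of exponents `a`, `b`. -/
def antisymFactor (s q : K) (a b : ℕ × ℤ) : K :=
  -((zeta s q a - zeta s q b) / (zeta s q a - s * zeta s q b))

theorem IsGeneric.sub_s_mul_ne_zero (h : IsGeneric s q) {a b : ℕ × ℤ} (hab : LSucc b a) :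
    zeta s q a - s * zeta s q b ≠ 0 := by
  intro e
  rw [h.s_mul_zeta] at e
  have := h.zeta_injective (sub_eq_zero.1 e)
  rw [Prod.ext_iff] at this
  unfold LSucc at hab
  dsimp only at this
  omega

theorem IsGeneric.antisymFactor_ne_zero (h : IsGeneric s q) {a b : ℕ × ℤ} (hab : LSucc b a) :
    antisymFactor s q a b ≠ 0 :=
  neg_ne_zero.2 (div_ne_zero (h.sub_ne_zero (Interacting.ne (Or.inl hab)))
    (h.sub_s_mul_ne_zero hab))

theorem IsGeneric.diagCoeff_add_one (h : IsGeneric s q) {a b : ℕ × ℤ} (hab : a ≠ b) :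
    diagCoeff s q a b + 1 = (s * zeta s q a - zeta s q b) / (zeta s q a - zeta s q b) := by
  have := h.sub_ne_zero hab
  rw [h.diagCoeff_eq]
  field_simp
  ring

/-- The cells at the positions `i`, `i + 1` carry the same value of `v` and are neighbours in a
row. -/
def RowNeighbours (i : Fin n) (x : Vertex n lam) : Prop :=
  x.2 i.castSucc = x.2 i.succ ∧ (cellAt x i.succ).1.1 = (cellAt x i.castSucc).1.1 ∧
    (cellAt x i.castSucc).1.2 = (cellAt x i.succ).1.2 + 1

/-- Coordinates of the vectors antisymmetric with respect to `T_i`: the two coordinates on an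
arrow `s_i` determine each other, and a coordinate vanishes where `T_i` acts by `s`. -/
theorem IsGeneric.wT_eq_neg_iff (h : IsGeneric s q) (i : Fin n) (f : W K n lam) :
    wT s q i f = -f ↔
      (∀ x y, Arrow i x y →
        f y = antisymFactor s q (label x i.castSucc) (label x i.succ) * f x) ∧
      ∀ x, RowNeighbours i x → f x = 0 := by
  have hcoord : wT s q i f = -f ↔ ∀ x,
      (diagCoeff s q (label x i.castSucc) (label x i.succ) + 1) * f x +
        swapCoeff s q (label x i.succ) (label x i.castSucc) * f (swapV i x) = 0 := by
    rw [Finsupp.ext_iff]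
    refine forall_congr' fun x => ?_
    rw [wT_apply, Finsupp.neg_apply, eq_neg_iff_add_eq_zero]
    refine Eq.congr ?_ rfl
    ring
  -- the coordinate at the target of an arrow
  have htarget : ∀ {x : Vertex n lam}, LSucc (label x i.succ) (label x i.castSucc) →
      ((diagCoeff s q (label (swapV i x) i.castSucc) (label (swapV i x) i.succ) + 1) *
        f (swapV i x) + swapCoeff s q (label (swapV i x) i.succ) (label (swapV i x) i.castSucc) *
          f (swapV i (swapV i x)) = 0 ↔
      f (swapV i x) = antisymFactor s q (label x i.castSucc) (label x i.succ) * f x) := by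
    intro x hl
    have hx : Swappable x i := Or.inl hl
    rw [hx.swapV_swapV, hx.label_swapV, hx.label_swapV, Equiv.swap_apply_left,
      Equiv.swap_apply_right, h.diagCoeff_add_one (label_ne_succ x i).symm,
      show swapCoeff s q (label x i.castSucc) (label x i.succ) = 1 from if_pos hl, antisymFactor]
    have h1 := h.sub_ne_zero (label_ne_succ x i)
    have h2 := h.sub_ne_zero (label_ne_succ x i).symm
    have h3 := h.sub_s_mul_ne_zero hl
    generalize zeta s q (label x i.castSucc) = a at *
    generalize zeta s q (label x i.succ) = b at *
    have e : (s * b - a) / (b - a) = (a - s * b) / (a - b) := by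
      rw [← neg_sub a b, ← neg_sub a (s * b), neg_div_neg_eq]
    rw [e, add_eq_zero_iff_eq_neg, neg_mul, div_mul_eq_mul_div, div_mul_eq_mul_div,
      div_eq_iff h1, ← neg_div, eq_div_iff h3]
    constructor <;> intro e <;> linear_combination e
  rw [hcoord]
  constructor
  · intro hf
    refine ⟨fun x y ha => ?_, fun x hx => ?_⟩
    · rw [ha.2.eq_swapV]
      exact (htarget ha.1).1 (hf _)
    · have hlab : label x i.castSucc = ((label x i.succ).1, (label x i.succ).2 + 1) := by
        rw [label_eq, label_eq]
        refine Prod.ext hx.1 ?_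
        have := hx.2
        dsimp only
        omega
      have hns : ¬ Swappable x i := by
        unfold Swappable LSucc
        rw [hlab]
        dsimp only
        omega
      have := hf x
      rw [swapCoeff_eq_zero (fun h => hns (Or.symm h)), zero_mul, add_zero,
        h.diagCoeff_add_one (label_ne_succ x i)] at this
      refine (mul_eq_zero.1 this).resolve_left (div_ne_zero ?_ (h.sub_ne_zero (label_ne_succ x i)))
      rw [hlab, ← h.s_mul_zeta, ← mul_assoc]
      intro e
      have h2 : zeta s q ((label x i.succ).1, (label x i.succ).2 + 1 + 1) =
          zeta s q (label x i.succ) := by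
        rw [← h.s_mul_zeta ((label x i.succ).1, (label x i.succ).2 + 1), ← h.s_mul_zeta]
        linear_combination e
      have h3 := congrArg Prod.snd (h.zeta_injective h2)
      dsimp only at h3
      omega
  · rintro ⟨hf1, hf2⟩ x
    by_cases hl : LSucc (label x i.succ) (label x i.castSucc)
    · rw [hf1 x _ (arrow_swapV_of_lSucc hl), h.diagCoeff_add_one (label_ne_succ x i),
        antisymFactor]
      have e := h.swapCoeff_mul_swapCoeff (Or.inl hl)
      rw [show swapCoeff s q (label x i.castSucc) (label x i.succ) = 1 from if_pos hl,
        one_mul] at e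
      rw [e]
      have h1 := h.sub_ne_zero (label_ne_succ x i)
      have h3 := h.sub_s_mul_ne_zero hl
      field_simp
      ring
    by_cases hl' : LSucc (label x i.castSucc) (label x i.succ)
    · have hx : Swappable x i := Or.inr hl'
      have ha := arrow_swapV_self_of_lSucc hl'
      have := (htarget ha.1).2 (by rw [hx.swapV_swapV]; exact hf1 _ _ ha)
      rwa [hx.swapV_swapV] at this
    · have hns : ¬ Swappable x i := fun h => h.elim hl hl'
      rw [swapCoeff_eq_zero (fun h => hns (Or.symm h)), zero_mul, add_zero]
      rcases (swappable_or x i).resolve_left hns with ⟨hv, hc | hc⟩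
      · rw [hf2 x ⟨hv, hc⟩, mul_zero]
      · rw [h.diagCoeff_add_one (label_ne_succ x i), h.s_mul_zeta]
        have : ((label x i.castSucc).1, (label x i.castSucc).2 + 1) = label x i.succ := by
          rw [label_eq, label_eq]
          refine Prod.ext hv ?_
          dsimp only
          omega
        rw [this, sub_self, zero_div, zero_mul]

/-! ### The vertices of a component -/

theorem vplus_rank (v : Fin (n + 1) → ℕ) (i : Fin (n + 1)) : vplus v (rank v i) = v i := by
  let e := Equiv.ofBijective (rank v) (rank_bijective v)
  have hm : Monotone ((OrderDual.toDual ∘ v) ∘ e.symm) := by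
    intro a b hab
    show v (e.symm b) ≤ v (e.symm a)
    by_contra hc
    have hb : RankBefore v (e.symm b) (e.symm a) := by
      have : e.symm b ≠ e.symm a := fun h => hc (by rw [h])
      unfold RankBefore
      omega
    have h1 := rank_lt_rank hb
    rw [show rank v (e.symm b) = b from e.apply_symm_apply b,
      show rank v (e.symm a) = a from e.apply_symm_apply a] at h1
    exact absurd hab (not_le.2 h1)
  have h1 := congrFun (Tuple.comp_sort_eq_comp_iff_monotone.2 hm) (rank v i)
  have h2 : e.symm (rank v i) = i := e.symm_apply_apply i
  simp only [Function.comp_apply, h2] at h1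
  exact (OrderDual.toDual_inj.1 h1).symm

variable {T : lam.cells → ℕ}

theorem mem_comp_iff {x : Vertex n lam} : x ∈ comp n T ↔ ∀ i, T (cellAt x i) = x.2 i := by
  have hfill : ∀ i, filling x (cellAt x i) = x.2 i := by
    intro i
    unfold filling cellAt
    rw [Equiv.symm_apply_apply, vplus_rank]
  constructor
  · intro hx i
    rw [← hfill, show filling x = T from hx]
  · intro hx
    refine funext fun c => ?_
    obtain ⟨i, rfl⟩ := (cellAt_bijective x).2 c
    rw [hfill, hx]

theorem Swappable.swapV_mem_comp {x : Vertex n lam} {i : Fin n} (h : Swappable x i)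
    (hx : x ∈ comp n T) : VVMac.swapV i x ∈ comp n T :=
  mem_comp_iff.2 fun k => by rw [h.cellAt_swapV, h.swapV_snd, mem_comp_iff.1 hx]

theorem Arrow.mem_comp {x y : Vertex n lam} {i : Fin n} (h : Arrow i x y) (hx : x ∈ comp n T) :
    y ∈ comp n T := by
  rw [h.2.eq_swapV]
  exact h.swappable.swapV_mem_comp hx

theorem Arrow.mem_comp_of_target {x y : Vertex n lam} {i : Fin n} (h : Arrow i x y)
    (hy : y ∈ comp n T) : x ∈ comp n T := by
  rw [h.2.eq_swapV] at hy
  have := h.swappable.swapV.swapV_mem_comp hy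
  rwa [h.swappable.swapV_swapV] at this

theorem isCompRoot_iff {x : Vertex n lam} : IsCompRoot T x ↔ x ∈ comp n T ∧ IsTerminal x := by
  unfold IsCompRoot
  rw [isTerminal_iff]

/-- Every vertex of a component is reached by arrows from a vertex without incoming arrow. -/
theorem comp_induction {motive : Vertex n lam → Prop}
    (root : ∀ x ∈ comp n T, IsTerminal x → motive x)
    (arrow : ∀ i x y, x ∈ comp n T → Arrow i x y → motive x → motive y) :
    ∀ x ∈ comp n T, motive x := by
  intro x
  induction hi : invCount x using Nat.strong_induction_on generalizing x with
  | _ m ih =>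
  intro hx
  by_cases ht : IsTerminal x
  · exact root x hx ht
  · unfold IsTerminal at ht
    push Not at ht
    obtain ⟨i, hl⟩ := ht
    have ha := arrow_swapV_self_of_lSucc hl
    have hm := ha.mem_comp_of_target hx
    exact arrow i _ x hm ha
      (ih (invCount (swapV i x)) (by have := ha.invCount_eq; omega) _ rfl hm)

/-- A component has at most one root: its cells are enumerated by increasing root key. -/
theorem IsTerminal.eq {x y : Vertex n lam} (hx : IsTerminal x) (hy : IsTerminal y)
    (hxT : x ∈ comp n T) (hyT : y ∈ comp n T) : x = y := by
  have hrange : ∀ z : Vertex n lam, z ∈ comp n T →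
      Set.range (fun i => rootKey (z.2 i) (cellAt z i)) =
        Set.range fun c => rootKey (T c) c := by
    intro z hz
    have : (fun i => rootKey (z.2 i) (cellAt z i)) = (fun c => rootKey (T c) c) ∘ cellAt z :=
      funext fun i => by rw [Function.comp_apply, mem_comp_iff.1 hz]
    rw [this, (cellAt_bijective z).2.range_comp]
  have h1 := (hx.strictMono.range_inj hy.strictMono).1 ((hrange x hxT).trans (hrange y hyT).symm)
  have h2 : ∀ i, x.2 i = y.2 i ∧ cellAt x i = cellAt y i := by
    intro i
    have := congrFun h1 i
    simp only [rootKey, EmbeddingLike.apply_eq_iff_eq, Prod.mk.injEq] at this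
    exact ⟨this.1, Subtype.ext (Prod.ext this.2.2 this.2.1)⟩
  exact vertex_ext (fun i => (h2 i).1) (fun i => (h2 i).2)

theorem exists_equiv_strictMono {α L : Type*} [Fintype α] [LinearOrder L] {k : ℕ}
    (hc : Fintype.card α = k) (key : α → L) (hinj : Function.Injective key) :
    ∃ e : Fin k ≃ α, StrictMono (key ∘ e) := by
  let _ : LinearOrder α := LinearOrder.lift' key hinj
  exact ⟨(Fintype.orderIsoFinOfCardEq α hc).toEquiv,
    fun _ _ hab => (Fintype.orderIsoFinOfCardEq α hc).lt_iff_lt.2 hab⟩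

/-- Enumerating the cells in a linear order for which larger values of `T`, and among equal values
cells further to the right in a row or higher in a column, come first, gives a vertex of the
component of `T`. -/
theorem exists_vertex_of_key (hcard : lam.card = n + 1) (hT : IsTableau T) {L : Type*}
    [LinearOrder L] (key : lam.cells → L) (hinj : Function.Injective key)
    (hval : ∀ c d, T c < T d → key d < key c)
    (hrow : ∀ c d, T c = T d → c.1.1 = d.1.1 → c.1.2 < d.1.2 → key d < key c)
    (hcol : ∀ c d, T c = T d → c.1.2 = d.1.2 → c.1.1 < d.1.1 → key d < key c) :
    ∃ x ∈ comp n T, StrictMono (key ∘ cellAt x) := by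
  have hc : Fintype.card lam.cells = n + 1 := by
    rw [Fintype.card_coe]
    exact hcard
  obtain ⟨e, he⟩ := exists_equiv_strictMono hc key hinj
  have hlt : ∀ a b, key (e b) < key (e a) → b < a := fun a b h => he.lt_iff_lt.1 h
  have hanti : Antitone (T ∘ e) := by
    intro a b hab
    by_contra hc
    exact absurd hab (not_le.2 (hlt _ _ (hval _ _ (not_le.1 hc))))
  have hR : IsRST e := by
    refine ⟨fun a b h1 h2 => hlt _ _ ?_, fun a b h1 h2 => hlt _ _ ?_⟩
    · rcases (hT.1 (e a) (e b) h1 h2.le).lt_or_eq with h3 | h3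
      · exact hval _ _ h3
      · exact hrow _ _ h3 h1 h2
    · rcases (hT.2 (e a) (e b) h1 h2.le).lt_or_eq with h3 | h3
      · exact hval _ _ h3
      · exact hcol _ _ h3 h1 h2
  have hcell : ∀ i, cellAt ((⟨e, hR⟩, T ∘ e) : Vertex n lam) i = e i := by
    intro i
    unfold cellAt
    rw [rank_of_antitone hanti]
  refine ⟨(⟨e, hR⟩, T ∘ e), mem_comp_iff.2 fun i => by rw [hcell]; rfl, fun a b hab => ?_⟩
  rw [Function.comp_apply, Function.comp_apply, hcell, hcell]
  exact he hab

/-- The order of cells by decreasing value of `T`, then by decreasing row, then by decreasing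
column. -/
def rowKey (T : lam.cells → ℕ) (c : lam.cells) : ℕᵒᵈ ×ₗ (ℕᵒᵈ ×ₗ ℕᵒᵈ) :=
  toLex (OrderDual.toDual (T c), toLex (OrderDual.toDual c.1.1, OrderDual.toDual c.1.2))

theorem rowKey_lt {c d : lam.cells} : rowKey T c < rowKey T d ↔
    T d < T c ∨ (T c = T d ∧ (d.1.1 < c.1.1 ∨ (c.1.1 = d.1.1 ∧ d.1.2 < c.1.2))) := by
  simp only [rowKey, Prod.Lex.toLex_lt_toLex, OrderDual.toDual_lt_toDual, OrderDual.toDual_inj]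

theorem rowKey_injective (T : lam.cells → ℕ) : Function.Injective (rowKey T) := by
  intro c d h
  simp only [rowKey, EmbeddingLike.apply_eq_iff_eq, Prod.mk.injEq] at h
  exact Subtype.ext (Prod.ext h.2.1 h.2.2)

theorem exists_vertex_rowKey (hcard : lam.card = n + 1) (hT : IsTableau T) :
    ∃ x ∈ comp n T, StrictMono (rowKey T ∘ cellAt x) :=
  exists_vertex_of_key hcard hT (rowKey T) (rowKey_injective T)
    (fun _ _ h => rowKey_lt.2 (Or.inl h))
    (fun _ _ h1 h2 h3 => rowKey_lt.2 (Or.inr ⟨h1.symm, Or.inr ⟨h2.symm, h3⟩⟩))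
    (fun _ _ h1 _ h3 => rowKey_lt.2 (Or.inr ⟨h1.symm, Or.inl h3⟩))

/-- If `T` has two equal entries in a row, its component contains a vertex with row neighbours:
the one for which the cells with equal value of `T` are enumerated row by row. -/
theorem exists_rowNeighbours (hcard : lam.card = n + 1) (hT : IsTableau T)
    (hrs : ¬ IsRowStrict T) : ∃ x ∈ comp n T, ∃ i, RowNeighbours i x := by
  unfold IsRowStrict at hrs
  push Not at hrs
  obtain ⟨c, d, hr, hlt, hle⟩ := hrs
  have hcd : T c = T d := le_antisymm (hT.1 c d hr hlt.le) hle
  -- the right neighbour of `c` has the same value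
  have hmem : (c.1.1, c.1.2 + 1) ∈ lam.cells :=
    YoungDiagram.up_left_mem lam hr.le hlt d.2
  obtain ⟨e, he⟩ : ∃ e : lam.cells, e.1 = (c.1.1, c.1.2 + 1) := ⟨⟨_, hmem⟩, rfl⟩
  have he1 : e.1.1 = c.1.1 := by rw [he]
  have he2 : e.1.2 = c.1.2 + 1 := by rw [he]
  have hce : T c = T e := le_antisymm (hT.1 c e he1.symm (by omega))
    ((hT.1 e d (he1.trans hr) (by omega)).trans hle)
  obtain ⟨x, hx, hmono⟩ := exists_vertex_rowKey hcard hT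
  obtain ⟨a, ha⟩ := (cellAt_bijective x).2 e
  obtain ⟨b, hb⟩ := (cellAt_bijective x).2 c
  have hab : a < b := by
    rw [← hmono.lt_iff_lt, Function.comp_apply, Function.comp_apply, ha, hb, rowKey_lt]
    omega
  have han : (a : ℕ) < n := by have := b.2; rw [Fin.lt_def] at hab; omega
  -- no cell is enumerated strictly between `e` and `c`
  have hbs : b = (⟨a, han⟩ : Fin n).succ := by
    by_contra hne
    have h1 : (⟨a, han⟩ : Fin n).succ < b := lt_of_le_of_ne
      (by rw [Fin.le_def, Fin.val_succ]; rw [Fin.lt_def] at hab; exact hab) (Ne.symm hne)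
    have h2 : a < (⟨a, han⟩ : Fin n).succ := by rw [Fin.lt_def, Fin.val_succ]; exact Nat.lt_succ_self _
    have h3 := hmono h1
    have h4 := hmono h2
    rw [Function.comp_apply, Function.comp_apply, rowKey_lt] at h3 h4
    rw [hb] at h3
    rw [ha] at h4
    omega
  refine ⟨x, hx, ⟨a, han⟩, ?_⟩
  unfold RowNeighbours
  rw [← hbs, show (⟨a, han⟩ : Fin n).castSucc = a from rfl, ha, hb, ← mem_comp_iff.1 hx,
    ← mem_comp_iff.1 hx, ha, hb]
  exact ⟨hce.symm, he1.symm, he2⟩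

theorem RowNeighbours.not_isRowStrict {x : Vertex n lam} {i : Fin n} (h : RowNeighbours i x)
    (hx : x ∈ comp n T) : ¬ IsRowStrict T := by
  intro hs
  have := hs (cellAt x i.succ) (cellAt x i.castSucc) h.2.1 (by have := h.2.2; omega)
  rw [mem_comp_iff.1 hx, mem_comp_iff.1 hx, h.1] at this
  exact lt_irrefl _ this

/-! ### The coefficients -/

open Classical in
/-- The product, over all inversions `i < j`, `ζ[i] ≻ ζ[j]`, of the factors that belong to an
arrow exchanging `ζ[j]` and `ζ[i]`. -/
def invProd (s q : K) (x : Vertex n lam) : K :=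
  ∏ p : Fin (n + 1) × Fin (n + 1) with p.1 < p.2,
    if LSucc (label x p.1) (label x p.2) then antisymFactor s q (label x p.2) (label x p.1) else 1

theorem IsGeneric.invProd_ne_zero (h : IsGeneric s q) (x : Vertex n lam) : invProd s q x ≠ 0 := by
  refine Finset.prod_ne_zero_iff.2 fun p _ => ?_
  split_ifs with hl
  · exact h.antisymFactor_ne_zero hl
  · exact one_ne_zero

theorem Arrow.invProd_eq {x y : Vertex n lam} {i : Fin n} (h : Arrow i x y) :
    invProd s q y =
      antisymFactor s q (label x i.castSucc) (label x i.succ) * invProd s q x := by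
  classical
  have := prod_pairs_swap (label x)
    (fun a b => if LSucc a b then antisymFactor s q b a else 1) i
  rw [if_neg (LSucc.asymm ((succ_iff _ _ _).1 h.1)), if_pos ((succ_iff _ _ _).1 h.1),
    mul_one, mul_comm _ (antisymFactor _ _ _ _)] at this
  unfold invProd
  rw [h.2.eq_swapV]
  simp only [h.swappable.label_swapV]
  convert this

theorem isAntisymCoeff_iff {b : comp n T → K} : IsAntisymCoeff s q T b ↔
    (∀ x : comp n T, IsTerminal x.1 → b x = 1) ∧
    ∀ (i : Fin n) (x y : comp n T), Arrow i x.1 y.1 →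
      b y = antisymFactor s q (label x.1 i.castSucc) (label x.1 i.succ) * b x := by
  refine and_congr (forall_congr' fun x => ?_) Iff.rfl
  rw [isCompRoot_iff]
  exact ⟨fun h hx => h ⟨x.2, hx⟩, fun h hx => h hx.2⟩

/-- Coefficients obeying the recursion along arrows are determined by their value at the root. -/
theorem eq_of_recursion {x₀ : Vertex n lam} (hx₀ : x₀ ∈ comp n T) (ht₀ : IsTerminal x₀)
    {b c : comp n T → K}
    (hb : ∀ (i : Fin n) (x y : comp n T), Arrow i x.1 y.1 →
      b y = antisymFactor s q (label x.1 i.castSucc) (label x.1 i.succ) * b x)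
    (hc : ∀ (i : Fin n) (x y : comp n T), Arrow i x.1 y.1 →
      c y = antisymFactor s q (label x.1 i.castSucc) (label x.1 i.succ) * c x)
    (h0 : b ⟨x₀, hx₀⟩ = c ⟨x₀, hx₀⟩) : b = c := by
  have := comp_induction (T := T) (motive := fun x => ∀ hx : x ∈ comp n T, b ⟨x, hx⟩ = c ⟨x, hx⟩)
    (fun x hx ht _ => by
      obtain rfl := ht.eq ht₀ hx hx₀
      exact h0)
    (fun i x y hx ha ih hy => by
      rw [hb i ⟨x, hx⟩ ⟨y, hy⟩ ha, hc i ⟨x, hx⟩ ⟨y, hy⟩ ha, ih hx])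
  exact funext fun x => this x.1 x.2 x.2

theorem toModel_combination (h : IsGeneric s q) (b : comp n T → K) :
    toModel lam n h (combination s q T b) = ∑ x : comp n T, b x • bas K x.1 := by
  unfold combination
  simp only [map_sum, map_smul, toModel_macdonald h]

theorem toModel_combination_apply (h : IsGeneric s q) (b : comp n T → K) (x : comp n T) :
    toModel lam n h (combination s q T b) x.1 = b x := by
  classical
  rw [toModel_combination, Finsupp.finsetSum_apply, Finset.sum_eq_single x]
  · simp
  · intro y _ hy
    rw [Finsupp.smul_apply, Finsupp.single_apply, if_neg (fun e => hy (Subtype.ext e)), smul_zero]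
  · exact fun hx => absurd (Finset.mem_univ _) hx

theorem toModel_combination_apply_of_notMem (h : IsGeneric s q) (b : comp n T → K)
    {x : Vertex n lam} (hx : x ∉ comp n T) : toModel lam n h (combination s q T b) x = 0 := by
  classical
  rw [toModel_combination, Finsupp.finsetSum_apply]
  refine Finset.sum_eq_zero fun y _ => ?_
  rw [Finsupp.smul_apply, Finsupp.single_apply, if_neg (by rintro rfl; exact hx y.2), smul_zero]

theorem mem_MT_iff {f : M K n lam} : f ∈ MT s q n T ↔ ∃ b, combination s q T b = f := by
  unfold MT combination
  rw [Set.image_eq_range, Submodule.mem_span_range_iff_exists_fun]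

/-- Antisymmetry of a combination of Macdonald polynomials in terms of its coefficients. -/
theorem combination_mem_antisymmetric_iff (h : IsGeneric s q) (b : comp n T → K) :
    combination s q T b ∈ antisymmetric s q n T ↔
      (∀ (i : Fin n) (x y : comp n T), Arrow i x.1 y.1 →
        b y = antisymFactor s q (label x.1 i.castSucc) (label x.1 i.succ) * b x) ∧
      ∀ (i : Fin n) (x : comp n T), RowNeighbours i x.1 → b x = 0 := by
  have h1 : combination s q T b ∈ antisymmetric s q n T ↔
      ∀ i, wT s q i (toModel lam n h (combination s q T b)) =
        -toModel lam n h (combination s q T b) := by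
    refine ⟨fun hf i => ?_, fun hf => ⟨mem_MT_iff.2 ⟨b, rfl⟩, fun i => ?_⟩⟩
    · rw [← toModel_bT, hf.2 i, map_neg]
    · apply toModel_injective h
      rw [toModel_bT, hf i, map_neg]
  rw [h1]
  simp only [h.wT_eq_neg_iff]
  constructor
  · intro hf
    refine ⟨fun i x y ha => ?_, fun i x hx => ?_⟩
    · rw [← toModel_combination_apply h b y, (hf i).1 x y ha, toModel_combination_apply]
    · rw [← toModel_combination_apply h b x, (hf i).2 x hx]
  · rintro ⟨hf1, hf2⟩ i
    refine ⟨fun x y ha => ?_, fun x hx => ?_⟩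
    · by_cases hm : x ∈ comp n T
      · rw [toModel_combination_apply h b ⟨x, hm⟩,
          toModel_combination_apply h b ⟨y, ha.mem_comp hm⟩]
        exact hf1 i ⟨x, hm⟩ ⟨y, ha.mem_comp hm⟩ ha
      · rw [toModel_combination_apply_of_notMem h b hm,
          toModel_combination_apply_of_notMem h b fun hy => hm (ha.mem_comp_of_target hy), mul_zero]
    · by_cases hm : x ∈ comp n T
      · rw [toModel_combination_apply h b ⟨x, hm⟩]
        exact hf2 i ⟨x, hm⟩ hx
      · exact toModel_combination_apply_of_notMem h b hm

end

end VVMac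

end

theorem mainTheorem4 {K : Type*} [Field K] [CharZero K] (s q : K)
    (hsq : AlgebraicIndependent ℚ ![s, q])
    (n : ℕ) (lam : YoungDiagram) (hcard : lam.card = n + 1)
    (T : lam.cells → ℕ) (hT : VVMac.IsTableau T) :
    (VVMac.IsRowStrict T →
      (∃! b : VVMac.comp n T → K, VVMac.IsAntisymCoeff s q T b) ∧
      (∀ b : VVMac.comp n T → K, VVMac.IsAntisymCoeff s q T b →
        VVMac.antisymmetric s q n T = Submodule.span K {VVMac.combination s q T b}) ∧
      Module.finrank K (VVMac.antisymmetric s q n T) = 1) ∧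
    (¬ VVMac.IsRowStrict T → VVMac.antisymmetric s q n T = ⊥) := by
  open VVMac in
  have h := isGeneric_of_algebraicIndependent hsq
  obtain ⟨x₀, hx₀, ht₀⟩ : ∃ x ∈ comp n T, IsTerminal x := by
    by_contra! hno
    obtain ⟨x, hx, -⟩ := exists_vertex_rowKey hcard hT
    exact comp_induction (T := T) (motive := fun _ => False) (fun x hx ht => hno x hx ht)
      (fun _ _ _ _ _ h => h) x hx
  let b₀ : comp n T → K := fun x => invProd s q x.1 / invProd s q x₀
  have hb₀ : IsAntisymCoeff s q T b₀ := by
    refine isAntisymCoeff_iff.2 ⟨fun x ht => ?_, fun i x y ha => ?_⟩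
    · show _ / _ = _
      rw [ht.eq ht₀ x.2 hx₀, div_self (h.invProd_ne_zero _)]
    · show _ / _ = _ * (_ / _)
      rw [ha.invProd_eq, mul_div_assoc]
  have huniq : ∀ b, IsAntisymCoeff s q T b → b = b₀ := fun b hb =>
    eq_of_recursion hx₀ ht₀ (isAntisymCoeff_iff.1 hb).2 (isAntisymCoeff_iff.1 hb₀).2
      (by rw [(isAntisymCoeff_iff.1 hb).1 _ ht₀, (isAntisymCoeff_iff.1 hb₀).1 _ ht₀])
  have hmult : ∀ b, combination s q T b ∈ antisymmetric s q n T →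
      b = b ⟨x₀, hx₀⟩ • b₀ := fun b hb =>
    eq_of_recursion hx₀ ht₀ ((combination_mem_antisymmetric_iff h b).1 hb).1
      (fun i x y ha => by
        rw [Pi.smul_apply, Pi.smul_apply, (isAntisymCoeff_iff.1 hb₀).2 i x y ha, mul_smul_comm])
      (by rw [Pi.smul_apply, (isAntisymCoeff_iff.1 hb₀).1 _ ht₀, smul_eq_mul, mul_one])
  refine ⟨fun hrs => ?_, fun hrs => ?_⟩
  · have hmem : combination s q T b₀ ∈ antisymmetric s q n T :=
      (combination_mem_antisymmetric_iff h b₀).2 ⟨(isAntisymCoeff_iff.1 hb₀).2,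
        fun i x hx => absurd hrs (hx.not_isRowStrict x.2)⟩
    have hspan : antisymmetric s q n T = Submodule.span K {combination s q T b₀} := by
      refine le_antisymm (fun f hf => ?_) ((Submodule.span_singleton_le_iff_mem _ _).2 hmem)
      obtain ⟨b, rfl⟩ := mem_MT_iff.1 hf.1
      refine Submodule.mem_span_singleton.2 ⟨b ⟨x₀, hx₀⟩, ?_⟩
      conv_rhs => rw [hmult b hf]
      unfold combination
      rw [Finset.smul_sum]
      simp only [Pi.smul_apply, smul_assoc]
    refine ⟨⟨b₀, hb₀, huniq⟩, fun b hb => huniq b hb ▸ hspan, ?_⟩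
    rw [hspan]
    refine finrank_span_singleton fun h0 => ?_
    have := toModel_combination_apply h b₀ ⟨x₀, hx₀⟩
    rw [h0, map_zero, Finsupp.zero_apply, (isAntisymCoeff_iff.1 hb₀).1 _ ht₀] at this
    exact zero_ne_one this
  · refine (Submodule.eq_bot_iff _).2 fun f hf => ?_
    obtain ⟨b, rfl⟩ := mem_MT_iff.1 hf.1
    obtain ⟨x, hx, i, hrow⟩ := exists_rowNeighbours hcard hT hrs
    have h1 := hmult b hf
    have h2 := ((combination_mem_antisymmetric_iff h b).1 hf).2 i ⟨x, hx⟩ hrow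
    rw [h1, Pi.smul_apply, smul_eq_mul] at h2
    have h3 : b ⟨x₀, hx₀⟩ = 0 := (mul_eq_zero.1 h2).resolve_right
      (div_ne_zero (h.invProd_ne_zero _) (h.invProd_ne_zero _))
    rw [h1, h3, zero_smul]
    simp [combination]
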